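/- Let $\nu\ge 1$ and let $\Omega\subset\mathbb R^\nu$ be a nonempty bounded open set. Let $\rho\in C^1(\Omega)$, let $w\in C^0(\Omega)$ satisfy $w\ge C$ on $\Omega$ for some constant $C>0$, and let $V$ be Lipschitz on $\Omega$, all real-valued. Put $\widetilde V:=V+|\nabla\rho|^2$ and suppose that $w$ and $\widetilde V w$ are integrable on $\Omega$. For $\varphi\in H^1(\Omega)$ (complex-valued) let $$\mathcal R(\varphi):=\frac{\int_\Omega\left(|\nabla\varphi|^2+V|\varphi|^2\right)w\,e^{-2\rho}\,dx}{\int_\Omega|\varphi|^2e^{-2\rho}\,dx},$$ and for $\ell=0,1,2,\dots$ define the variational Neumann eigenvalue $$\mu_\ell:=\sup_{\dim \mathfrak S=\ell}\ \inf\left\{\mathcal R(\varphi):\ \varphi\in H^1(\Omega),\ \varphi\perp\mathfrak S,\ \|\varphi\|=1\right\}\in[-\infty,\infty],$$ where $\mathfrak S$ ranges over the $\ell$-dimensional subspaces of $L^2(\Omega,e^{-2\rho}dx)$, orthogonality and the norm are those of $L^2(\Omega,e^{-2\rho}dx)$, and $\varphi$ is restricted to those elements of $H^1(\Omega)$ for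 which $|\varphi|^2e^{-2\rho}$, $|\nabla\varphi|^2we^{-2\rho}$ and $V|\varphi|^2we^{-2\rho}$ are integrable on $\Omega$ (all of $H^1(\Omega)$ if $\rho$ and $w$ are bounded). Then for every integer $k\ge 1$ $$\frac1k\sum_{j=0}^{k-1}\mu_j\ \le\ \frac{4\pi^2\nu}{\nu+2}\left(\frac{k}{|\Omega|\,\omega_\nu}\right)^{2/\nu}\frac1{|\Omega|}\int_\Omega w\,dx+\frac1{|\Omega|}\int_\Omega\widetilde V\,w\,dx,$$ where $|\Omega|$ is the Lebesgue measure of $\Omega$ and $\omega_\nu$ is the volume of the unit ball of $\mathbb R^\nu$. -/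

import Mathlib

open MeasureTheory
open scoped ContDiff Gradient

noncomputable section

/-- `G` is the distributional gradient of `φ` on the open set `Ω ⊆ ℝ^ν`: for every real test
function `η ∈ C_c^∞(Ω)` and every `i`, one has `∫_Ω φ ∂ᵢη dx = - ∫_Ω Gᵢ η dx`. -/
def IsWeakGradient {ν : ℕ} (Ω : Set (EuclideanSpace ℝ (Fin ν)))
    (φ : EuclideanSpace ℝ (Fin ν) → ℂ)
    (G : EuclideanSpace ℝ (Fin ν) → EuclideanSpace ℂ (Fin ν)) : Prop :=
  LocallyIntegrableOn φ Ω ∧ LocallyIntegrableOn G Ω ∧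
    ∀ η : EuclideanSpace ℝ (Fin ν) → ℝ, ContDiff ℝ ∞ η → HasCompactSupport η → tsupport η ⊆ Ω →
      ∀ i : Fin ν,
        ∫ x in Ω, (fderiv ℝ η x (EuclideanSpace.single i 1)) • φ x = -∫ x in Ω, η x • (G x) i

/-- `φ ∈ H¹(Ω)` with weak gradient `G`: both `φ` and `G` are square integrable for Lebesgue
measure on `Ω`. The gradient `G` is determined by `φ` almost everywhere on `Ω`. -/
def MemH1 {ν : ℕ} (Ω : Set (EuclideanSpace ℝ (Fin ν)))
    (φ : EuclideanSpace ℝ (Fin ν) → ℂ)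
    (G : EuclideanSpace ℝ (Fin ν) → EuclideanSpace ℂ (Fin ν)) : Prop :=
  MemLp φ 2 (volume.restrict Ω) ∧ MemLp G 2 (volume.restrict Ω) ∧ IsWeakGradient Ω φ G

/-- The measure `e^{-2ρ} dx` on `Ω`. -/
def weightedMeasure {ν : ℕ} (Ω : Set (EuclideanSpace ℝ (Fin ν)))
    (ρ : EuclideanSpace ℝ (Fin ν) → ℝ) : Measure (EuclideanSpace ℝ (Fin ν)) :=
  (volume.restrict Ω).withDensity fun x => ENNReal.ofReal (Real.exp (-2 * ρ x))

/-- The complex Hilbert space `L²(Ω, e^{-2ρ} dx)`. -/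
abbrev WeightedL2 {ν : ℕ} (Ω : Set (EuclideanSpace ℝ (Fin ν)))
    (ρ : EuclideanSpace ℝ (Fin ν) → ℝ) : Type :=
  Lp ℂ 2 (weightedMeasure Ω ρ)

/-- The Rayleigh quotient
`R(φ) = ∫_Ω (|∇φ|² + V |φ|²) w e^{-2ρ} dx / ∫_Ω |φ|² e^{-2ρ} dx`, where `G = ∇φ`. -/
def rayleighQuotient {ν : ℕ} (Ω : Set (EuclideanSpace ℝ (Fin ν)))
    (ρ w V : EuclideanSpace ℝ (Fin ν) → ℝ) (φ : EuclideanSpace ℝ (Fin ν) → ℂ)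
    (G : EuclideanSpace ℝ (Fin ν) → EuclideanSpace ℂ (Fin ν)) : ℝ :=
  (∫ x in Ω, (‖G x‖ ^ 2 + V x * ‖φ x‖ ^ 2) * w x * Real.exp (-2 * ρ x)) /
    ∫ x in Ω, ‖φ x‖ ^ 2 * Real.exp (-2 * ρ x)

/-- Admissible trial functions: `φ ∈ L²(Ω, e^{-2ρ} dx)` that lie in `H¹(Ω)`, with gradient `G`,
and for which both parts of the energy are finite, so that the Rayleigh quotient makes sense.
When `ρ`, `w` and `V` are bounded on `Ω` these are exactly the elements of `H¹(Ω)`. -/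
def IsTrialFunction {ν : ℕ} (Ω : Set (EuclideanSpace ℝ (Fin ν)))
    (ρ w V : EuclideanSpace ℝ (Fin ν) → ℝ) (φ : WeightedL2 Ω ρ)
    (G : EuclideanSpace ℝ (Fin ν) → EuclideanSpace ℂ (Fin ν)) : Prop :=
  MemH1 Ω φ G ∧
    IntegrableOn (fun x => ‖G x‖ ^ 2 * w x * Real.exp (-2 * ρ x)) Ω ∧
    IntegrableOn (fun x => V x * ‖φ x‖ ^ 2 * w x * Real.exp (-2 * ρ x)) Ω

/-- The variational Neumann eigenvalue `μ_ℓ`, `ℓ = 0, 1, 2, …`: the supremum over all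
`ℓ`-dimensional subspaces `S` of `L²(Ω, e^{-2ρ} dx)` of the infimum of the Rayleigh quotient over
the trial functions of norm one that are orthogonal to `S`. The value is an extended real number,
since the energy need not be bounded below if `w` is unbounded and `V` takes negative values. -/
def neumannEigenvalue {ν : ℕ} (Ω : Set (EuclideanSpace ℝ (Fin ν)))
    (ρ w V : EuclideanSpace ℝ (Fin ν) → ℝ) (ℓ : ℕ) : EReal :=
  ⨆ (S : Submodule ℂ (WeightedL2 Ω ρ)) (_ : Module.rank ℂ S = ℓ),
    ⨅ (φ : WeightedL2 Ω ρ) (G : EuclideanSpace ℝ (Fin ν) → EuclideanSpace ℂ (Fin ν))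
      (_ : IsTrialFunction Ω ρ w V φ G ∧ φ ∈ Sᗮ ∧ ‖φ‖ = 1),
      (rayleighQuotient Ω ρ w V φ G : EReal)

end

/-! The proof is an averaged variational principle applied to plane waves. Let `Q` be a Hermitian
form with eigenvalues `l 0 ≤ l 1 ≤ ...`, and let `f i` be a finite family with the Bessel bound `∑
|⟪f i, u⟫|² ≤ c ‖u‖²`. Expanding `∑ Q(f i)` in eigenvectors gives a weighted sum of eigenvalues in
which every weight is at most `c`. If the total weight `∑ ‖f i‖²` is at least `k c`, such a sum is
smallest when the weight fills the lowest eigenvalues. Hence the mean of `l 0, ..., l (k - 1)` is at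
most `∑ Q(f i) / ∑ ‖f i‖²`.

The trial functions are `exp (i⟪ξ, x⟫) e^ρ`. The factor `e^ρ` cancels the weight `e^{-2ρ}`, so in
the limit the norm squared is `|Ω|` and the energy is `∫ (|ξ|² + |∇ρ|² + V) w`. As `e^ρ` need not
belong to `H¹(Ω)`, it is replaced by `e^ρ / (1 + ε e^ρ)`, which is bounded and whose logarithmic
derivative is still at most that of `e^ρ`.

The frequencies are the points of `2π n⁻¹ ℤ^ν` in a ball of radius `2πr`. On a cube of side `n`
containing `Ω` these waves are orthogonal with norm squared `n^ν`, so Parseval gives the constant `c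
= n^ν`. The family is finite, so only linear algebra in the span of the trial functions is needed:
no eigenfunction of the Neumann problem has to exist, and `μ_j` is bounded by the `j`-th eigenvalue
of the compressed form through a dimension count (`neumannEigenvalue_le`).

As `n → ∞` the lattice sums become integrals over a ball: the condition on the total weight becomes
`k < ω_ν r^ν ∫ (1 + ε e^ρ)⁻²`, and the mean of `|ξ|²` becomes `4π² r² ν / (ν + 2)`. Letting `ε → 0`
and then `r` decrease to `(k / (|Ω| ω_ν))^{1/ν}` gives the bound. -/

/-! ### The averaged variational principle in finite dimension -/

section AveragedVariationalPrinciple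

open Module

/-- If `d ≤ S` has total mass `k * S`, the `d`-weighted sum of a nondecreasing sequence is at least
`S` times the sum of its first `k` terms. -/
theorem sum_mul_le_sum_mul_of_monotone {N k : ℕ} (hk : 1 ≤ k) (hkN : k ≤ N) {l d : ℕ → ℝ} {S : ℝ}
    (hl : ∀ i j, i ≤ j → j < N → l i ≤ l j) (hd0 : ∀ j < N, 0 ≤ d j) (hdS : ∀ j < N, d j ≤ S)
    (hsum : ∑ j ∈ Finset.range N, d j = k * S) :
    (∑ j ∈ Finset.range k, l j) * S ≤ ∑ j ∈ Finset.range N, l j * d j := by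
  -- Both factors change sign at the threshold `k`. In the sum of these products the constant `l (k
  -- - 1)` drops out, because `d` and `S` times the indicator of `j < k` have the same total mass.
  have hterm : ∀ j ∈ Finset.range N,
      0 ≤ (l j - l (k - 1)) * (d j - if j < k then S else 0) := by
    intro j hj
    rw [Finset.mem_range] at hj
    split_ifs with h
    · exact mul_nonneg_of_nonpos_of_nonpos
        (sub_nonpos.2 (hl _ _ (by omega) (by omega))) (sub_nonpos.2 (hdS j hj))
    · exact mul_nonneg (sub_nonneg.2 (hl _ _ (by omega) hj)) (by simpa using hd0 j hj)
  have hfilter : (Finset.range N).filter (· < k) = Finset.range k := by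
    ext j; simp; omega
  have hind : ∀ g : ℕ → ℝ, ∑ j ∈ Finset.range N, g j * (if j < k then S else 0) =
      (∑ j ∈ Finset.range k, g j) * S := by
    intro g
    rw [Finset.sum_mul, ← hfilter, Finset.sum_filter]
    exact Finset.sum_congr rfl fun j _ => by split_ifs <;> simp
  have h1 := hind fun _ => 1
  have h2 := hind l
  have := Finset.sum_nonneg hterm
  simp only [sub_mul, mul_sub, Finset.sum_sub_distrib, ← Finset.mul_sum, hsum, h2] at this
  simp only [one_mul, Finset.sum_const, Finset.card_range, nsmul_eq_mul, mul_one] at h1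
  rw [h1] at this
  linarith

/-- In an eigenbasis `u` of `A`, the weights `k ∑ |⟪f m, u i⟫|²` are at most `k c ≤ S` by Bessel and
add up to `k S` by Parseval, where `S = ∑ ‖f i‖²`. The rearrangement inequality above then applies.
The spaces `W` are what a min-max argument needs. -/
theorem LinearMap.IsSymmetric.exists_subspaces_sum_le {F : Type*} [NormedAddCommGroup F]
    [InnerProductSpace ℂ F] [FiniteDimensional ℂ F] {A : F →ₗ[ℂ] F} (hA : A.IsSymmetric)
    {ι : Type*} (s : Finset ι) (f : ι → F) {c : ℝ} (hc : 0 < c)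
    (hBessel : ∀ u : F, ∑ i ∈ s, ‖inner ℂ (f i) u‖ ^ 2 ≤ c * ‖u‖ ^ 2) {k : ℕ} (hk1 : 1 ≤ k)
    (hk : k * c ≤ ∑ i ∈ s, ‖f i‖ ^ 2) :
    ∃ l : ℕ → ℝ, (∀ j < k, ∃ W : Submodule ℂ F, finrank ℂ W = j + 1 ∧
        ∀ x ∈ W, (inner ℂ x (A x)).re ≤ l j * ‖x‖ ^ 2) ∧
      (∑ j ∈ Finset.range k, l j) * ∑ i ∈ s, ‖f i‖ ^ 2 ≤
        k * ∑ i ∈ s, (inner ℂ (f i) (A (f i))).re := by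
  obtain ⟨N, hN⟩ : ∃ N, finrank ℂ F = N := ⟨_, rfl⟩
  -- `eigenvalues` is decreasing; diagonalizing `-A` lists the eigenvalues `-e i` of `A` in
  -- increasing order.
  have hA' : (-A).IsSymmetric := fun x y => by simp [hA x y]
  set u := hA'.eigenvectorBasis hN
  set e := hA'.eigenvalues hN
  have hanti : Antitone e := hA'.eigenvalues_antitone hN
  have hAu : ∀ i, A (u i) = ((-e i : ℝ) : ℂ) • u i := fun i => by
    have := hA'.apply_eigenvectorBasis hN i
    rw [LinearMap.neg_apply, neg_eq_iff_eq_neg] at this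
    rw [this]
    simp [u, e]
  have hform : ∀ x, (inner ℂ x (A x)).re = ∑ i, -e i * ‖inner ℂ (u i) x‖ ^ 2 := by
    intro x
    rw [← u.sum_inner_mul_inner, Complex.re_sum]
    refine Finset.sum_congr rfl fun i _ => ?_
    rw [← hA, hAu, inner_smul_left, Complex.conj_ofReal, mul_left_comm, Complex.re_ofReal_mul,
      ← inner_conj_symm, mul_comm (starRingEnd ℂ _), Complex.mul_conj, Complex.ofReal_re,
      Complex.normSq_eq_norm_sq]
  have hnorm : ∀ x, ‖x‖ ^ 2 = ∑ i, ‖inner ℂ (u i) x‖ ^ 2 := fun x =>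
    (u.sum_sq_norm_inner_right x).symm
  set d : Fin N → ℝ := fun i => k * ∑ m ∈ s, ‖inner ℂ (f m) (u i)‖ ^ 2
  set S := ∑ i ∈ s, ‖f i‖ ^ 2
  have hd : ∀ g : Fin N → ℝ, ∑ i, g i * d i =
      k * ∑ m ∈ s, ∑ i, g i * ‖inner ℂ (u i) (f m)‖ ^ 2 := by
    intro g
    rw [Finset.sum_comm, Finset.mul_sum]
    refine Finset.sum_congr rfl fun i _ => ?_
    simp only [d, Finset.mul_sum]
    refine Finset.sum_congr rfl fun m _ => ?_
    rw [norm_inner_symm]; ring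
  have hdS : ∀ i, d i ≤ S := fun i => by
    have := hBessel (u i)
    rw [u.norm_eq_one, one_pow, mul_one] at this
    exact (mul_le_mul_of_nonneg_left this (Nat.cast_nonneg k)).trans hk
  have hdsum : ∑ i, d i = k * S := by
    have := hd fun _ => 1
    simp only [one_mul, ← hnorm] at this
    exact this
  have hkR : (0 : ℝ) < k := by exact_mod_cast hk1
  have hS : 0 < S := (mul_pos hkR hc).trans_le hk
  -- `N` weights, each at most `S`, have total mass `k S`.
  have hkN : k ≤ N := by
    have h1 : ∑ i, d i ≤ ∑ _i : Fin N, S := Finset.sum_le_sum fun i _ => hdS i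
    rw [hdsum, Finset.sum_const, Finset.card_univ, Fintype.card_fin, nsmul_eq_mul] at h1
    exact_mod_cast le_of_mul_le_mul_right h1 hS
  -- The default `0` is never used, since only indices below `N` occur. The subspace for `j` is
  -- spanned by the first `j + 1` eigenvectors.
  refine ⟨fun j => if h : j < N then -e ⟨j, h⟩ else 0, fun j hj => ?_, ?_⟩
  · have hjN : j < N := hj.trans_le hkN
    let v : Fin (j + 1) → F := fun i => u (Fin.castLE hjN i)
    have hv : Orthonormal ℂ v := u.orthonormal.comp _ (Fin.castLE_injective _)
    refine ⟨Submodule.span ℂ (Set.range v), ?_, fun x hx => ?_⟩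
    · rw [finrank_span_eq_card hv.linearIndependent, Fintype.card_fin]
    · have hzero : ∀ i : Fin N, j < i → inner ℂ (u i) x = 0 := by
        intro i hi
        induction hx using Submodule.span_induction with
        | mem x h =>
          obtain ⟨m, rfl⟩ := h
          refine u.orthonormal.2 fun h => ?_
          have := m.2
          rw [h] at hi
          simp at hi
          omega
        | zero => simp
        | add x y _ _ h1 h2 => rw [inner_add_right, h1, h2, add_zero]
        | smul a x _ h => rw [inner_smul_right, h, mul_zero]
      simp only [dif_pos hjN]
      rw [hform, hnorm, Finset.mul_sum]
      refine Finset.sum_le_sum fun i _ => ?_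
      by_cases h : j < i
      · simp [hzero i h]
      · refine mul_le_mul_of_nonneg_right (neg_le_neg (hanti ?_)) (sq_nonneg _)
        exact Fin.mk_le_mk.2 (not_lt.1 h)
  · set l : ℕ → ℝ := fun j => if h : j < N then -e ⟨j, h⟩ else 0
    set d' : ℕ → ℝ := fun j => if h : j < N then d ⟨j, h⟩ else 0
    have hd' : ∀ g : ℕ → ℝ, ∑ j ∈ Finset.range N, g j * d' j = ∑ i : Fin N, g i * d i := by
      intro g
      rw [Finset.sum_range]
      simp [d']
    have key := sum_mul_le_sum_mul_of_monotone (l := l) (d := d') (S := S) hk1 hkN ?_ ?_ ?_ ?_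
    · refine key.trans_eq ?_
      rw [hd', hd]
      simp [l, hform]
    · intro i j hij hj
      simp only [l, hj, hij.trans_lt hj, dif_pos]
      exact neg_le_neg (hanti (Fin.mk_le_mk.2 hij))
    · intro j hj
      simp only [d', hj, dif_pos]
      exact mul_nonneg hkR.le (Finset.sum_nonneg fun _ _ => sq_nonneg _)
    · intro j hj
      simp only [d', hj, dif_pos]
      exact hdS _
    · rw [← hdsum]
      simpa using hd' fun _ => 1

/-- The averaged variational principle for a Hermitian form on the coefficients of a finite
linearly independent family. -/
theorem Matrix.IsHermitian.exists_subspaces_sum_le {H : Type*} [NormedAddCommGroup H]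
    [InnerProductSpace ℂ H] {ι : Type*} [Fintype ι] [DecidableEq ι] {B : Matrix ι ι ℂ}
    (hB : B.IsHermitian) (T : (ι → ℂ) →ₗ[ℂ] H) (hT : Function.Injective T) {c : ℝ} (hc : 0 < c)
    (hbound : ∀ a, ‖T a‖ ^ 2 ≤ c * ∑ i, ‖a i‖ ^ 2) {k : ℕ} (hk1 : 1 ≤ k)
    (hk : k * c ≤ ∑ i, ‖T (Pi.single i 1)‖ ^ 2) :
    ∃ l : ℕ → ℝ, (∀ j < k, ∃ W : Submodule ℂ (ι → ℂ), finrank ℂ W = j + 1 ∧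
        ∀ a ∈ W, (star a ⬝ᵥ B.mulVec a).re ≤ l j * ‖T a‖ ^ 2) ∧
      (∑ j ∈ Finset.range k, l j) * ∑ i, ‖T (Pi.single i 1)‖ ^ 2 ≤ k * ∑ i, (B i i).re := by
  let e : (ι → ℂ) ≃ₗ[ℂ] LinearMap.range T := LinearEquiv.ofInjective T hT
  let v := stdOrthonormalBasis ℂ (LinearMap.range T)
  have he : ∀ a, ((e a : LinearMap.range T) : H) = T a := fun a => rfl
  -- The operator on the range of `T` representing the form `B`, written in an orthonormal basis of
  -- that range.
  let A : LinearMap.range T →ₗ[ℂ] LinearMap.range T :=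
    { toFun := fun y => ∑ i, (star (e.symm (v i)) ⬝ᵥ B.mulVec (e.symm y)) • v i
      map_add' := fun x y => by
        simp only [map_add, Matrix.mulVec_add, dotProduct_add, add_smul, Finset.sum_add_distrib]
      map_smul' := fun a x => by
        simp only [map_smul, Matrix.mulVec_smul, dotProduct_smul, smul_assoc, Finset.smul_sum,
          RingHom.id_apply] }
  have hAin : ∀ x y, inner ℂ x (A y) = star (e.symm x) ⬝ᵥ B.mulVec (e.symm y) := by
    intro x y
    conv_rhs => rw [← v.sum_repr' x]
    simp only [map_sum, map_smul, star_sum, star_smul, sum_dotProduct, smul_dotProduct]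
    simp only [A, LinearMap.coe_mk, AddHom.coe_mk, inner_sum, inner_smul_right]
    refine Finset.sum_congr rfl fun i _ => ?_
    rw [mul_comm, ← inner_conj_symm, smul_eq_mul]
    rfl
  have hA : A.IsSymmetric := by
    intro x y
    rw [← inner_conj_symm, hAin, hAin, ← Complex.star_def, ← Matrix.star_dotProduct,
      Matrix.star_mulVec, hB.eq, Matrix.dotProduct_mulVec]
  have hdiag : ∀ i, star (Pi.single i 1 : ι → ℂ) ⬝ᵥ B.mulVec (Pi.single i 1) = B i i := by
    intro i
    rw [← Pi.single_star, star_one, Matrix.mulVec_single_one, single_one_dotProduct]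
    rfl
  -- Duality: the bound on `T` is also one on its adjoint. With `a i = ⟪T eᵢ, u⟫` one has `∑ |a i|²
  -- = ⟪T a, u⟫ ≤ ‖T a‖ ‖u‖`, and `‖T a‖` is controlled by `∑ |a i|²` again.
  have hBessel : ∀ u : LinearMap.range T,
      ∑ i, ‖inner ℂ (e (Pi.single i 1)) u‖ ^ 2 ≤ c * ‖u‖ ^ 2 := by
    intro u
    set a : ι → ℂ := fun i => inner ℂ (e (Pi.single i 1)) u
    set s := ∑ i, ‖a i‖ ^ 2
    have ha : e a = ∑ i, a i • e (Pi.single i 1) := by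
      conv_lhs => rw [pi_eq_sum_univ' a]
      simp [map_sum, map_smul]
    have h1 : inner ℂ (e a) u = (s : ℂ) := by
      rw [ha, sum_inner]
      simp only [inner_smul_left, s, Complex.ofReal_sum]
      refine Finset.sum_congr rfl fun i _ => ?_
      rw [mul_comm, Complex.mul_conj, Complex.normSq_eq_norm_sq]
    have hs : 0 ≤ s := Finset.sum_nonneg fun _ _ => sq_nonneg _
    have h2 : s ≤ ‖e a‖ * ‖u‖ := by
      have := norm_inner_le_norm (𝕜 := ℂ) (e a) u
      rwa [h1, Complex.norm_real, Real.norm_of_nonneg hs] at this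
    have h3 : ‖e a‖ ^ 2 ≤ c * s := hbound a
    rcases hs.eq_or_lt with h | h
    · rw [← h]; positivity
    · have h4 : s ^ 2 ≤ c * s * ‖u‖ ^ 2 := calc
        s ^ 2 ≤ (‖e a‖ * ‖u‖) ^ 2 := by gcongr
        _ = ‖e a‖ ^ 2 * ‖u‖ ^ 2 := by ring
        _ ≤ _ := by gcongr
      nlinarith
  obtain ⟨l, h1, h2⟩ := hA.exists_subspaces_sum_le Finset.univ (fun i => e (Pi.single i 1)) hc
    hBessel hk1 hk
  refine ⟨l, fun j hj => ?_, ?_⟩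
  · obtain ⟨W, hW, hWl⟩ := h1 j hj
    refine ⟨W.map e.symm.toLinearMap, ?_, ?_⟩
    · rw [← hW]
      exact (e.symm.submoduleMap W).finrank_eq.symm
    · rintro _ ⟨x, hx, rfl⟩
      have := hWl x hx
      rw [hAin] at this
      refine this.trans_eq ?_
      rw [← he]
      simp
  · refine h2.trans_eq ?_
    simp only [hAin, LinearEquiv.symm_apply_apply, hdiag]

end AveragedVariationalPrinciple

/-! ### Riemann sums over lattice points in a ball -/

section LatticePoints

open Filter Topology Module
open scoped Pointwise

/-- The point `m / n` of the lattice `n⁻¹ ℤ^ν`. -/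
noncomputable def latticePoint {ν : ℕ} (n : ℕ) (m : Fin ν → ℤ) : EuclideanSpace ℝ (Fin ν) :=
  WithLp.toLp 2 fun i => (m i : ℝ) / n

/-- The integer points `m` with `‖m / n‖ < r`. -/
abbrev LatticeBall (ν n : ℕ) (r : ℝ) : Type := {m : Fin ν → ℤ // ‖latticePoint n m‖ < r}

theorem finite_latticeBall (ν : ℕ) {n : ℕ} (hn : n ≠ 0) (r : ℝ) : Finite (LatticeBall ν n r) := by
  have hn' : (0 : ℝ) < n := by exact_mod_cast Nat.pos_of_ne_zero hn
  have : ({m : Fin ν → ℤ | ‖latticePoint n m‖ < r}).Finite := by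
    refine (Set.Finite.pi' (t := fun _ : Fin ν => Set.Icc (-⌈r * n⌉) ⌈r * n⌉)
      fun _ => Set.finite_Icc _ _).subset fun m hm i => ?_
    have h1 : |(m i : ℝ) / n| < r := lt_of_le_of_lt (PiLp.norm_apply_le (latticePoint n m) i) hm
    rw [abs_div, abs_of_pos hn', div_lt_iff₀ hn'] at h1
    have h2 : |(m i : ℝ)| ≤ (⌈r * n⌉ : ℤ) := h1.le.trans (Int.le_ceil _)
    rw [Set.mem_Icc, ← abs_le]
    exact_mod_cast h2
  exact this

/-- A Riemann sum with mesh `1 / n`; it converges because the sphere bounding the ball is a null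
set. It is used for the number of frequencies (`F = 1`) and for their second moment (`F = ‖x‖²`). -/
theorem tendsto_tsum_latticeBall {ν : ℕ} {F : EuclideanSpace ℝ (Fin ν) → ℝ} (hF : Continuous F)
    (r : ℝ) :
    Tendsto (fun n : ℕ => (∑' m : LatticeBall ν n r, F (latticePoint n m)) / (n : ℝ) ^ ν) atTop
      (𝓝 (∫ x in Metric.ball 0 r, F x)) := by
  have hvp := PiLp.volume_preserving_toLp (Fin ν)
  set s : Set (Fin ν → ℝ) := WithLp.toLp 2 ⁻¹' Metric.ball (0 : EuclideanSpace ℝ (Fin ν)) r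
  let e : (Fin ν → ℝ) ≃ₜ EuclideanSpace ℝ (Fin ν) :=
    (EuclideanSpace.equiv (Fin ν) ℝ).symm.toHomeomorph
  have hs1 : Bornology.IsBounded s := by
    have := Metric.isBounded_ball (x := (0 : EuclideanSpace ℝ (Fin ν))) (r := r)
    refine ((EuclideanSpace.equiv (Fin ν) ℝ).lipschitz.isBounded_image this).subset ?_
    exact fun x hx => ⟨WithLp.toLp 2 x, hx, rfl⟩
  have hs2 : MeasurableSet s := Metric.isOpen_ball.measurableSet.preimage hvp.measurable
  have hs3 : volume (frontier s) = 0 := by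
    have h1 : frontier s = WithLp.toLp 2 ⁻¹'
        frontier (Metric.ball (0 : EuclideanSpace ℝ (Fin ν)) r) :=
      (e.preimage_frontier _).symm
    rw [h1, hvp.measure_preimage_emb e.measurableEmbedding]
    exact (convex_ball _ _).addHaar_frontier _
  have key := tendsto_tsum_div_pow_atTop_integral s (fun x => F (WithLp.toLp 2 x))
    (hF.comp e.continuous) hs1 hs2 hs3
  rw [hvp.setIntegral_preimage_emb e.measurableEmbedding F] at key
  refine key.congr' ?_
  filter_upwards [eventually_ne_atTop 0] with n hn
  rw [Fintype.card_fin]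
  congr 1
  have hn' : (n : ℝ) ≠ 0 := by exact_mod_cast hn
  have : NeZero n := ⟨hn⟩
  have hmem : ∀ m : Fin ν → ℤ, (fun i => (m i : ℝ) / n) ∈
      (n : ℝ)⁻¹ • (Submodule.span ℤ (Set.range (Pi.basisFun ℝ (Fin ν))) : Set (Fin ν → ℝ)) := by
    intro m
    rw [← Submodule.coe_pointwise_smul, SetLike.mem_coe,
      BoxIntegral.unitPartition.mem_smul_span_iff]
    intro i
    exact ⟨m i, by simp; field_simp⟩
  let g : LatticeBall ν n r → ↑(s ∩ (n : ℝ)⁻¹ •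
      (Submodule.span ℤ (Set.range (Pi.basisFun ℝ (Fin ν))) : Set (Fin ν → ℝ))) :=
    fun m => ⟨fun i => (m.1 i : ℝ) / n, by
      have h := m.2
      rw [latticePoint, ← mem_ball_zero_iff] at h
      exact h, hmem m.1⟩
  have hg : Function.Bijective g := by
    constructor
    · intro m m' h
      ext i
      have := congrFun (congrArg Subtype.val h) i
      simp only [g] at this
      have := (div_left_inj' hn').1 this
      exact_mod_cast this
    · rintro ⟨x, hx1, hx2⟩
      rw [← Submodule.coe_pointwise_smul, SetLike.mem_coe,
      BoxIntegral.unitPartition.mem_smul_span_iff] at hx2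
      choose m hm using hx2
      have hx : x = fun i => (m i : ℝ) / n := by
        ext i
        have := hm i
        simp at this
        rw [this]; field_simp
      refine ⟨⟨m, ?_⟩, ?_⟩
      · rw [latticePoint, ← hx, ← mem_ball_zero_iff]
        exact hx1
      · simp only [g, hx]
  exact ((Equiv.ofBijective g hg).tsum_eq fun x => F (WithLp.toLp 2 x.1)).symm

/-- Polar coordinates; this is the source of the factor `ν / (ν + 2)`. -/
theorem setIntegral_ball_norm_sq {ν : ℕ} (hν : 1 ≤ ν) {r : ℝ} (hr : 0 ≤ r) :
    ∫ x in Metric.ball (0 : EuclideanSpace ℝ (Fin ν)) r, ‖x‖ ^ 2 =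
      ν / (ν + 2) * volume.real (Metric.ball (0 : EuclideanSpace ℝ (Fin ν)) 1) * r ^ (ν + 2) := by
  have : Nontrivial (EuclideanSpace ℝ (Fin ν)) :=
    Module.nontrivial_of_finrank_pos (R := ℝ) (by simp; omega)
  have h1 : ∫ x in Metric.ball (0 : EuclideanSpace ℝ (Fin ν)) r, ‖x‖ ^ 2 =
      ∫ x : EuclideanSpace ℝ (Fin ν), (Set.Iio r).indicator (fun t : ℝ => t ^ 2) ‖x‖ := by
    rw [← integral_indicator Metric.isOpen_ball.measurableSet]
    congr 1
    ext x
    by_cases h : ‖x‖ < r <;> simp [Set.indicator, h]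
  have h2 : ∫ y in Set.Ioi (0 : ℝ), y ^ (ν - 1) • (Set.Iio r).indicator (fun t : ℝ => t ^ 2) y =
      r ^ (ν + 2) / (ν + 2) := by
    have : ∀ y : ℝ, y ^ (ν - 1) • (Set.Iio r).indicator (fun t : ℝ => t ^ 2) y =
        (Set.Iio r).indicator (fun t : ℝ => t ^ (ν + 1)) y := by
      intro y
      by_cases h : y < r
      · simp only [Set.indicator, Set.mem_Iio, h, if_true, smul_eq_mul, ← pow_add]
        congr 1; omega
      · simp [Set.indicator, h]
    simp only [this]
    rw [setIntegral_indicator measurableSet_Iio, Set.Ioi_inter_Iio, ← integral_Ioc_eq_integral_Ioo,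
      ← intervalIntegral.integral_of_le hr, integral_pow]
    push_cast
    simp
    ring_nf
  rw [h1, integral_fun_norm_addHaar, finrank_euclideanSpace_fin, h2, nsmul_eq_mul, smul_eq_mul]
  ring

end LatticePoints

/-! ### Upper bounds for the variational eigenvalues -/

section MinMax

open Module

variable {ν : ℕ} {Ω : Set (EuclideanSpace ℝ (Fin ν))} {ρ w V : EuclideanSpace ℝ (Fin ν) → ℝ}

/-- A space of dimension `ℓ + 1` contains a nonzero vector orthogonal to any given `S` of dimension
`ℓ`: the projection `W → S` has a nontrivial kernel. -/
theorem neumannEigenvalue_le {ℓ : ℕ} {l : ℝ} (W : Submodule ℂ (WeightedL2 Ω ρ))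
    (hW : finrank ℂ W = ℓ + 1)
    (h : ∀ φ ∈ W, ‖φ‖ = 1 → ∃ G, IsTrialFunction Ω ρ w V φ G ∧ rayleighQuotient Ω ρ w V φ G ≤ l) :
    neumannEigenvalue Ω ρ w V ℓ ≤ l := by
  refine iSup₂_le fun S hS => ?_
  have : FiniteDimensional ℂ W := finite_of_finrank_pos (by omega)
  have : FiniteDimensional ℂ S :=
    rank_lt_aleph0_iff.1 (by rw [hS]; exact Cardinal.natCast_lt_aleph0)
  have hS' : finrank ℂ S = ℓ := finrank_eq_of_rank_eq hS
  let P : W →ₗ[ℂ] S := S.orthogonalProjectionOnto.toLinearMap ∘ₗ W.subtype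
  obtain ⟨x, hx, hx0⟩ := Submodule.exists_mem_ne_zero_of_ne_bot
    (LinearMap.ker_ne_bot_of_finrank_lt (f := P) (by omega))
  have hxS : (x : WeightedL2 Ω ρ) ∈ Sᗮ := by
    rw [← Submodule.orthogonalProjectionOnto_eq_zero_iff]
    exact hx
  have hx0' : (x : WeightedL2 Ω ρ) ≠ 0 := by simpa using hx0
  obtain ⟨G, hG1, hG2⟩ := h (((‖(x : WeightedL2 Ω ρ)‖⁻¹ : ℝ) : ℂ) • (x : WeightedL2 Ω ρ))
    (W.smul_mem _ x.2) (by rw [norm_smul]; simp [hx0'])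
  refine iInf_le_of_le _ (iInf_le_of_le G (iInf_le_of_le ⟨hG1, Sᗮ.smul_mem _ hxS, ?_⟩ ?_))
  · rw [norm_smul]; simp [hx0']
  · exact_mod_cast hG2

end MinMax

/-! ### Plane waves and Parseval's identity on a cube -/

section PlaneWaves

open Complex Topology

/-- The plane wave `x ↦ exp (i ⟪ξ, x⟫)`. -/
noncomputable def planeWave {ν : ℕ} (ξ x : EuclideanSpace ℝ (Fin ν)) : ℂ :=
  exp ((inner ℝ ξ x : ℝ) * I)

variable {ν : ℕ}

theorem norm_planeWave (ξ x : EuclideanSpace ℝ (Fin ν)) : ‖planeWave ξ x‖ = 1 :=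
  norm_exp_ofReal_mul_I _

theorem conj_planeWave_mul (ξ η x : EuclideanSpace ℝ (Fin ν)) :
    starRingEnd ℂ (planeWave ξ x) * planeWave η x = planeWave (η - ξ) x := by
  rw [planeWave, planeWave, planeWave, ← exp_conj, ← exp_add, inner_sub_left]
  congr 1
  simp only [map_mul, conj_ofReal, conj_I, ofReal_sub]
  ring

theorem analyticOnNhd_planeWave (ξ : EuclideanSpace ℝ (Fin ν)) :
    AnalyticOnNhd ℝ (planeWave ξ) Set.univ := by
  intro x _
  have h1 : AnalyticAt ℝ (fun x : EuclideanSpace ℝ (Fin ν) => ((inner ℝ ξ x : ℝ) : ℂ) * I) x :=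
    ((ofRealCLM ∘L innerSL ℝ ξ).analyticAt x).mul analyticAt_const
  exact (analyticAt_cexp.restrictScalars (𝕜 := ℝ)).comp h1

theorem continuous_planeWave (ξ : EuclideanSpace ℝ (Fin ν)) : Continuous (planeWave ξ) :=
  (analyticOnNhd_planeWave ξ).continuous

theorem planeWave_eq_prod (ξ x : EuclideanSpace ℝ (Fin ν)) :
    planeWave ξ x = ∏ i, exp ((ξ i * I) * x i) := by
  rw [planeWave, ← exp_sum]
  congr 1
  simp only [PiLp.inner_apply, ofReal_sum, Finset.sum_mul]
  refine Finset.sum_congr rfl fun i _ => ?_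
  simp
  ring

/-- The half-open cube of side `n` centered at the origin. -/
def centeredCube (ν n : ℕ) : Set (EuclideanSpace ℝ (Fin ν)) :=
  {x | ∀ i, x i ∈ Set.Ioc (-(n : ℝ) / 2) (n / 2)}

theorem centeredCube_eq_preimage (ν n : ℕ) : WithLp.toLp 2 ⁻¹' centeredCube ν n =
    Set.univ.pi fun _ : Fin ν => Set.Ioc (-(n : ℝ) / 2) (n / 2) := by
  ext x
  simp [centeredCube]

theorem isBounded_centeredCube (ν n : ℕ) : Bornology.IsBounded (centeredCube ν n) := by
  have h : Bornology.IsBounded (Set.univ.pi fun _ : Fin ν => Set.Ioc (-(n : ℝ) / 2) (n / 2)) :=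
    Bornology.IsBounded.pi fun _ => Metric.isBounded_Ioc _ _
  refine ((EuclideanSpace.equiv (Fin ν) ℝ).symm.lipschitz.isBounded_image h).subset ?_
  rw [← centeredCube_eq_preimage]
  exact fun x hx => ⟨x.ofLp, hx, rfl⟩

/-- For `m ≠ 0` the primitive takes the same value at both ends, as the exponents there differ by
`2πi m`. -/
theorem integral_Ioc_exp_two_pi_div {n : ℕ} (hn : n ≠ 0) (m : ℤ) :
    ∫ t in Set.Ioc (-(n : ℝ) / 2) (n / 2), exp (((2 * Real.pi * (m / n) : ℝ) * I) * t) =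
      if m = 0 then (n : ℂ) else 0 := by
  have hn' : (n : ℝ) ≠ 0 := by exact_mod_cast hn
  have hnC : (n : ℂ) ≠ 0 := by exact_mod_cast hn
  have hle : -(n : ℝ) / 2 ≤ n / 2 := by
    have : (0 : ℝ) ≤ n := Nat.cast_nonneg n
    linarith
  split_ifs with hm
  · simp [hm, hle]
    ring
  · have hmC : (m : ℂ) ≠ 0 := by exact_mod_cast hm
    have hpi : (Real.pi : ℂ) ≠ 0 := by exact_mod_cast Real.pi_ne_zero
    have hc : ((2 * Real.pi * (m / n) : ℝ) : ℂ) * I ≠ 0 := by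
      push_cast
      exact mul_ne_zero (mul_ne_zero (mul_ne_zero two_ne_zero hpi) (div_ne_zero hmC hnC)) I_ne_zero
    rw [← intervalIntegral.integral_of_le hle, integral_exp_mul_complex hc, div_eq_zero_iff]
    left
    rw [sub_eq_zero, exp_eq_exp_iff_exists_int]
    refine ⟨m, ?_⟩
    push_cast
    field_simp
    ring

theorem setIntegral_centeredCube_planeWave {n : ℕ} (hn : n ≠ 0) (m : Fin ν → ℤ) :
    ∫ x in centeredCube ν n, planeWave ((2 * Real.pi) • latticePoint n m) x =
      if m = 0 then (n : ℂ) ^ ν else 0 := by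
  have hvp := PiLp.volume_preserving_toLp (Fin ν)
  have hemb : MeasurableEmbedding (WithLp.toLp 2 : (Fin ν → ℝ) → EuclideanSpace ℝ (Fin ν)) :=
    (EuclideanSpace.equiv (Fin ν) ℝ).symm.toHomeomorph.measurableEmbedding
  rw [← hvp.setIntegral_preimage_emb hemb, centeredCube_eq_preimage, volume_pi,
    Measure.restrict_pi_pi]
  simp only [planeWave_eq_prod]
  rw [integral_fintype_prod_eq_prod (μ := fun _ : Fin ν =>
      (volume : Measure ℝ).restrict (Set.Ioc (-(n : ℝ) / 2) (n / 2)))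
    (f := fun i (t : ℝ) => exp ((((2 * Real.pi) • latticePoint n m) i * I) * t))]
  have : ∀ i, ((2 * Real.pi) • latticePoint n m) i = 2 * Real.pi * (m i / n) := fun i => rfl
  simp only [this, integral_Ioc_exp_two_pi_div hn]
  split_ifs with hm
  · simp [hm]
  · obtain ⟨i, hi⟩ := Function.ne_iff.1 hm
    exact Finset.prod_eq_zero (Finset.mem_univ i) (if_neg hi)

theorem integrableOn_planeWave {s : Set (EuclideanSpace ℝ (Fin ν))} (hs : Bornology.IsBounded s)
    (ξ : EuclideanSpace ℝ (Fin ν)) : IntegrableOn (planeWave ξ) s :=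
  ((continuous_planeWave ξ).continuousOn.integrableOn_compact
    hs.isCompact_closure).mono_set subset_closure

theorem setIntegral_centeredCube_norm_sum_sq {n : ℕ} (hn : n ≠ 0) {ι : Type*} [Fintype ι]
    {m : ι → Fin ν → ℤ} (hm : Function.Injective m) (a : ι → ℂ) :
    ∫ x in centeredCube ν n,
        ‖∑ i, a i * planeWave ((2 * Real.pi) • latticePoint n (m i)) x‖ ^ 2 =
      (n : ℝ) ^ ν * ∑ i, ‖a i‖ ^ 2 := by
  classical
  have h1 : ∀ x, ((‖∑ i, a i * planeWave ((2 * Real.pi) • latticePoint n (m i)) x‖ ^ 2 : ℝ) : ℂ) =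
      ∑ i, ∑ j, starRingEnd ℂ (a i) * a j *
        planeWave ((2 * Real.pi) • latticePoint n (m j - m i)) x := by
    intro x
    rw [ofReal_pow, ← conj_mul', map_sum, Finset.sum_mul_sum]
    refine Finset.sum_congr rfl fun i _ => Finset.sum_congr rfl fun j _ => ?_
    have : (2 * Real.pi) • latticePoint n (m j - m i) =
        (2 * Real.pi) • latticePoint n (m j) - (2 * Real.pi) • latticePoint n (m i) := by
      rw [← smul_sub]
      congr 1
      ext k
      simp [latticePoint, sub_div]
    rw [this, ← conj_planeWave_mul, map_mul]
    ring
  apply ofReal_injective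
  rw [← integral_complex_ofReal]
  simp only [h1]
  have hint : ∀ i j, Integrable (fun x => starRingEnd ℂ (a i) * a j *
      planeWave ((2 * Real.pi) • latticePoint n (m j - m i)) x)
      (volume.restrict (centeredCube ν n)) := fun i j =>
    (integrableOn_planeWave (isBounded_centeredCube ν n) _).const_mul _
  rw [integral_finsetSum _ fun i _ => integrable_finsetSum _ fun j _ => hint i j]
  simp only [integral_finsetSum _ fun j _ => hint _ j, integral_const_mul,
    setIntegral_centeredCube_planeWave hn, sub_eq_zero, hm.eq_iff]
  simp only [mul_ite, mul_zero, Finset.sum_ite_eq', Finset.mem_univ, if_true, conj_mul']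
  rw [ofReal_mul, ofReal_sum, Finset.mul_sum]
  refine Finset.sum_congr rfl fun i _ => ?_
  push_cast
  ring

/-- A trigonometric sum is real analytic, so vanishing on `U` forces vanishing everywhere, in
particular on the cube, where Parseval gives `a = 0`. -/
theorem eq_zero_of_sum_planeWave_eq_zero {U : Set (EuclideanSpace ℝ (Fin ν))} (hU : IsOpen U)
    (hU' : U.Nonempty) {n : ℕ} (hn : n ≠ 0) {ι : Type*} [Fintype ι]
    {m : ι → Fin ν → ℤ} (hm : Function.Injective m) {a : ι → ℂ}
    (ha : ∀ x ∈ U, ∑ i, a i * planeWave ((2 * Real.pi) • latticePoint n (m i)) x = 0) : a = 0 := by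
  have han : AnalyticOnNhd ℝ
      (fun x => ∑ i, a i * planeWave ((2 * Real.pi) • latticePoint n (m i)) x) Set.univ :=
    Finset.analyticOnNhd_fun_sum _ fun i _ =>
      analyticOnNhd_const.mul (analyticOnNhd_planeWave _)
  obtain ⟨x, hx⟩ := hU'
  have h0 := han.eqOn_zero_of_preconnected_of_eventuallyEq_zero isPreconnected_univ
    (Set.mem_univ x) (Filter.eventually_of_mem (hU.mem_nhds hx) ha)
  have h1 := setIntegral_centeredCube_norm_sum_sq hn hm a
  rw [integral_congr_ae (g := fun _ => (0 : ℝ))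
    (Filter.Eventually.of_forall fun x => by simpa using h0 (Set.mem_univ x)),
    integral_zero] at h1
  have hn' : (n : ℝ) ^ ν ≠ 0 := pow_ne_zero _ (by exact_mod_cast hn)
  have h2 := (mul_eq_zero.1 h1.symm).resolve_left hn'
  rw [Finset.sum_eq_zero_iff_of_nonneg fun _ _ => sq_nonneg _] at h2
  ext i
  simpa using h2 i (Finset.mem_univ i)

end PlaneWaves

/-! ### Classical derivatives as weak gradients -/

section WeakGradient

open Topology

variable {ν : ℕ} {Ω : Set (EuclideanSpace ℝ (Fin ν))}

/-- Integration by parts on the whole space. The behaviour of `φ` outside `Ω` is irrelevant because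
derivatives of `φ` are needed only on the compact support of `η`. -/
theorem isWeakGradient_of_hasLineDerivAt (hΩ : IsOpen Ω) {φ : EuclideanSpace ℝ (Fin ν) → ℂ}
    {G : EuclideanSpace ℝ (Fin ν) → EuclideanSpace ℂ (Fin ν)} (hφ : ContinuousOn φ Ω)
    (hG : ContinuousOn G Ω)
    (h : ∀ x ∈ Ω, ∀ i, HasLineDerivAt ℝ φ (G x i) x (EuclideanSpace.single i 1)) :
    IsWeakGradient Ω φ G := by
  refine ⟨hφ.locallyIntegrableOn hΩ.measurableSet, hG.locallyIntegrableOn hΩ.measurableSet, ?_⟩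
  intro η hη hηc hηΩ i
  set v : EuclideanSpace ℝ (Fin ν) := EuclideanSpace.single i 1
  have hGi : ContinuousOn (fun x => G x i) Ω :=
    (EuclideanSpace.proj (𝕜 := ℂ) i).continuous.comp_continuousOn hG
  have hη' : Continuous fun x => fderiv ℝ η x v :=
    (hη.continuous_fderiv (by simp)).clm_apply continuous_const
  have hη'0 : ∀ x ∉ tsupport η, fderiv ℝ η x v = 0 := fun x hx => by
    have : fderiv ℝ η x = 0 :=
      Function.notMem_support.1 fun h' => hx (support_fderiv_subset ℝ h')
    rw [this, zero_apply]
  have hη0 : ∀ x ∉ tsupport η, η x = 0 := fun x hx => image_eq_zero_of_notMem_tsupport hx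
  have hint : ∀ (a : EuclideanSpace ℝ (Fin ν) → ℝ) (b : EuclideanSpace ℝ (Fin ν) → ℂ),
      Continuous a → ContinuousOn b Ω → (∀ x ∉ tsupport η, a x = 0) →
      Integrable (fun x => a x • b x) := by
    intro a b ha hb ha0
    rw [← integrableOn_iff_integrable_of_support_subset (s := tsupport η)]
    · exact (ha.continuousOn.smul (hb.mono hηΩ)).integrableOn_compact hηc
    · intro x hx
      by_contra hx'
      exact hx (by simp [ha0 x hx'])
  have key := integral_bilinear_hasLineDerivAt_right_eq_neg_left_of_integrable
    (μ := (volume : Measure (EuclideanSpace ℝ (Fin ν)))) (f := η) (f' := fun x => fderiv ℝ η x v)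
    (g := φ) (g' := fun x => G x i) (v := v) (B := ContinuousLinearMap.lsmul ℝ ℝ)
    (hint _ _ hη' hφ hη'0) (hint _ _ hη.continuous hGi hη0) (hint _ _ hη.continuous hφ hη0)
    (fun x _ => ((hη.differentiable (by simp)).differentiableAt.hasFDerivAt).hasLineDerivAt v)
    (fun x hx => h x (hηΩ hx) i)
  simp only [ContinuousLinearMap.lsmul_apply] at key
  rw [setIntegral_eq_integral_of_forall_compl_eq_zero,
    setIntegral_eq_integral_of_forall_compl_eq_zero, key, neg_neg]
  · intro x hx
    simp [hη0 x fun h' => hx (hηΩ h')]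
  · intro x hx
    simp [hη'0 x fun h' => hx (hηΩ h')]

theorem IsWeakGradient.congr_ae {φ ψ : EuclideanSpace ℝ (Fin ν) → ℂ}
    {G : EuclideanSpace ℝ (Fin ν) → EuclideanSpace ℂ (Fin ν)} (h : IsWeakGradient Ω φ G)
    (hψ : IntegrableOn ψ Ω) (hφψ : φ =ᵐ[volume.restrict Ω] ψ) : IsWeakGradient Ω ψ G := by
  refine ⟨hψ.locallyIntegrableOn, h.2.1, fun η h1 h2 h3 i => ?_⟩
  rw [← h.2.2 η h1 h2 h3 i]
  refine integral_congr_ae ?_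
  filter_upwards [hφψ] with x hx
  rw [hx]

end WeakGradient

/-! ### The weighted space `L²(Ω, e^{-2ρ} dx)` -/

section WeightedMeasure

variable {ν : ℕ} {Ω : Set (EuclideanSpace ℝ (Fin ν))} {ρ : EuclideanSpace ℝ (Fin ν) → ℝ}

theorem aemeasurable_weight (hΩ : MeasurableSet Ω) (hρ : ContinuousOn ρ Ω) :
    AEMeasurable (fun x => ENNReal.ofReal (Real.exp (-2 * ρ x))) (volume.restrict Ω) :=
  ((Real.continuous_exp.comp_continuousOn (continuousOn_const.mul hρ)).aemeasurable
    hΩ).ennreal_ofReal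

/-- The density is positive everywhere. This carries identities between elements of the weighted
`L²` back to Lebesgue-a.e. statements. -/
theorem restrict_absolutelyContinuous_weightedMeasure (hΩ : MeasurableSet Ω)
    (hρ : ContinuousOn ρ Ω) : volume.restrict Ω ≪ weightedMeasure Ω ρ :=
  withDensity_absolutelyContinuous' (aemeasurable_weight hΩ hρ)
    (Filter.Eventually.of_forall fun x => by simp [Real.exp_pos])

theorem integral_weightedMeasure (hΩ : MeasurableSet Ω) (hρ : ContinuousOn ρ Ω)
    (f : EuclideanSpace ℝ (Fin ν) → ℝ) :
    ∫ x, f x ∂weightedMeasure Ω ρ = ∫ x in Ω, f x * Real.exp (-2 * ρ x) := by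
  rw [weightedMeasure, integral_withDensity_eq_integral_toReal_smul₀ (aemeasurable_weight hΩ hρ)
    (Filter.Eventually.of_forall fun x => by simp)]
  simp [ENNReal.toReal_ofReal, Real.exp_nonneg, mul_comm]

theorem memLp_weightedMeasure (hΩ : MeasurableSet Ω) (hρ : ContinuousOn ρ Ω)
    {f : EuclideanSpace ℝ (Fin ν) → ℂ} (hf : ContinuousOn f Ω)
    (hint : IntegrableOn (fun x => ‖f x‖ ^ 2 * Real.exp (-2 * ρ x)) Ω) :
    MemLp f 2 (weightedMeasure Ω ρ) := by
  have h1 : AEStronglyMeasurable f (weightedMeasure Ω ρ) :=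
    (hf.aestronglyMeasurable hΩ).mono_ac (withDensity_absolutelyContinuous _ _)
  rw [memLp_two_iff_integrable_sq_norm h1, weightedMeasure,
    integrable_withDensity_iff_integrable_smul₀' (aemeasurable_weight hΩ hρ)
      (Filter.Eventually.of_forall fun x => by simp)]
  refine hint.congr (Filter.Eventually.of_forall fun x => ?_)
  simp [ENNReal.toReal_ofReal, Real.exp_nonneg, mul_comm]

theorem WeightedL2.norm_sq_eq (hΩ : MeasurableSet Ω) (hρ : ContinuousOn ρ Ω)
    (φ : WeightedL2 Ω ρ) : ‖φ‖ ^ 2 = ∫ x in Ω, ‖φ x‖ ^ 2 * Real.exp (-2 * ρ x) := by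
  have h1 : ((‖φ‖ ^ 2 : ℝ) : ℂ) = ((∫ x, ‖φ x‖ ^ 2 ∂weightedMeasure Ω ρ : ℝ) : ℂ) := by
    rw [← integral_complex_ofReal, Complex.ofReal_pow, ← Complex.coe_algebraMap,
      ← inner_self_eq_norm_sq_to_K (𝕜 := ℂ), L2.inner_def]
    refine integral_congr_ae (Filter.Eventually.of_forall fun x => ?_)
    simp [inner_self_eq_norm_sq_to_K]
  rw [← integral_weightedMeasure hΩ hρ]
  exact_mod_cast h1

end WeightedMeasure

/-! ### The energy form on a finite family -/

section EnergyMatrix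

variable {X : Type*} [MeasurableSpace X] {μ : Measure X} {ι : Type*} {ν : ℕ}

/-- The matrix of the form `∫ ⟪u, u'⟫ + V p̄ p' dμ` on the family of pairs `(u i, p i)`. -/
noncomputable def energyMatrix (μ : Measure X) (V : X → ℝ) (u : ι → X → EuclideanSpace ℂ (Fin ν))
    (p : ι → X → ℂ) : Matrix ι ι ℂ :=
  Matrix.of fun i j => ∫ x, inner ℂ (u i x) (u j x) + V x * inner ℂ (p i x) (p j x) ∂μ

theorem isHermitian_energyMatrix (V : X → ℝ) (u : ι → X → EuclideanSpace ℂ (Fin ν))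
    (p : ι → X → ℂ) : (energyMatrix μ V u p).IsHermitian := by
  ext i j
  simp only [energyMatrix, Matrix.conjTranspose_apply, Matrix.of_apply, Complex.star_def]
  rw [← integral_conj]
  refine integral_congr_ae (Filter.Eventually.of_forall fun x => ?_)
  simp only [map_add, map_mul, inner_conj_symm, Complex.conj_ofReal]

theorem energyMatrix_apply_self (V : X → ℝ) (u : ι → X → EuclideanSpace ℂ (Fin ν))
    (p : ι → X → ℂ) (i : ι) :
    (energyMatrix μ V u p i i).re = ∫ x, ‖u i x‖ ^ 2 + V x * ‖p i x‖ ^ 2 ∂μ := by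
  simp only [energyMatrix, Matrix.of_apply, inner_self_eq_norm_sq_to_K, Complex.coe_algebraMap]
  norm_cast

theorem MemLp.integrable_inner {E : Type*} [NormedAddCommGroup E] [InnerProductSpace ℂ E]
    {f g : X → E} (hf : MemLp f 2 μ) (hg : MemLp g 2 μ) :
    Integrable (fun x => inner ℂ (f x) (g x)) μ := by
  refine (L2.integrable_inner (𝕜 := ℂ) (hf.toLp f) (hg.toLp g)).congr ?_
  filter_upwards [hf.coeFn_toLp, hg.coeFn_toLp] with x h1 h2
  rw [h1, h2]

theorem star_dotProduct_energyMatrix_mulVec [Fintype ι] {V : X → ℝ} (hV : AEStronglyMeasurable V μ) {M : ℝ}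
    (hVM : ∀ᵐ x ∂μ, ‖V x‖ ≤ M) {u : ι → X → EuclideanSpace ℂ (Fin ν)} {p : ι → X → ℂ}
    (hu : ∀ i, MemLp (u i) 2 μ) (hp : ∀ i, MemLp (p i) 2 μ) (a : ι → ℂ) :
    (star a ⬝ᵥ (energyMatrix μ V u p).mulVec a).re =
      ∫ x, ‖∑ i, a i • u i x‖ ^ 2 + V x * ‖∑ i, a i • p i x‖ ^ 2 ∂μ := by
  have hint : ∀ i j, Integrable
      (fun x => inner ℂ (u i x) (u j x) + V x * inner ℂ (p i x) (p j x)) μ := fun i j =>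
    (MemLp.integrable_inner (hu i) (hu j)).add
      ((MemLp.integrable_inner (hp i) (hp j)).bdd_mul (c := M)
        (Complex.continuous_ofReal.comp_aestronglyMeasurable hV) (by simpa using hVM))
  have hsq : ∀ {E : Type} [NormedAddCommGroup E] [InnerProductSpace ℂ E] (f : ι → E),
      ((‖∑ i, a i • f i‖ ^ 2 : ℝ) : ℂ) =
        ∑ i, ∑ j, star (a i) * a j * inner ℂ (f i) (f j) := by
    intro E _ _ f
    rw [Complex.ofReal_pow, ← Complex.coe_algebraMap, ← inner_self_eq_norm_sq_to_K (𝕜 := ℂ),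
      sum_inner]
    simp only [inner_sum, inner_smul_left, inner_smul_right, mul_assoc, Complex.star_def]
    exact Finset.sum_congr rfl fun i _ => Finset.sum_congr rfl fun j _ => mul_left_comm _ _ _
  have h1 : star a ⬝ᵥ (energyMatrix μ V u p).mulVec a =
      ((∫ x, ‖∑ i, a i • u i x‖ ^ 2 + V x * ‖∑ i, a i • p i x‖ ^ 2 ∂μ : ℝ) : ℂ) := by
    rw [← integral_complex_ofReal]
    have : ∀ x, ((‖∑ i, a i • u i x‖ ^ 2 + V x * ‖∑ i, a i • p i x‖ ^ 2 : ℝ) : ℂ) =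
        ∑ i, ∑ j, star (a i) * a j *
          (inner ℂ (u i x) (u j x) + V x * inner ℂ (p i x) (p j x)) := by
      intro x
      rw [Complex.ofReal_add, Complex.ofReal_mul, hsq, hsq, Finset.mul_sum,
        ← Finset.sum_add_distrib]
      refine Finset.sum_congr rfl fun i _ => ?_
      rw [Finset.mul_sum, ← Finset.sum_add_distrib]
      refine Finset.sum_congr rfl fun j _ => ?_
      ring
    simp only [this]
    rw [integral_finsetSum _ fun i _ => integrable_finsetSum _ fun j _ => (hint i j).const_mul _]
    simp only [integral_finsetSum _ fun j _ => (hint _ j).const_mul _, integral_const_mul]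
    simp only [dotProduct, Matrix.mulVec, energyMatrix, Matrix.of_apply, Pi.star_apply,
      Finset.mul_sum]
    refine Finset.sum_congr rfl fun i _ => Finset.sum_congr rfl fun j _ => ?_
    ring
  rw [h1, Complex.ofReal_re]

end EnergyMatrix

/-! ### Damped trial functions -/

section TrialFunctions

open Complex

variable {ν : ℕ}

/-- The factor `1 / (1 + ε e^t)`, which makes `e^t / (1 + ε e^t)` bounded. -/
noncomputable def damping (ε t : ℝ) : ℝ := (1 + ε * Real.exp t)⁻¹

theorem damping_pos {ε : ℝ} (hε : 0 < ε) (t : ℝ) : 0 < damping ε t := by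
  unfold damping; positivity

theorem damping_le_one {ε : ℝ} (hε : 0 < ε) (t : ℝ) : damping ε t ≤ 1 :=
  inv_le_one_of_one_le₀ (le_add_of_nonneg_right (by positivity))

theorem exp_mul_damping_le {ε : ℝ} (hε : 0 < ε) (t : ℝ) : Real.exp t * damping ε t ≤ ε⁻¹ := by
  unfold damping
  rw [← div_eq_mul_inv, div_le_iff₀ (by positivity), mul_add, inv_mul_cancel_left₀ hε.ne']
  have : 0 < ε⁻¹ := inv_pos.2 hε
  linarith

theorem continuous_damping {ε : ℝ} (hε : 0 < ε) : Continuous (damping ε) := by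
  unfold damping
  exact (by fun_prop : Continuous fun t => 1 + ε * Real.exp t).inv₀ fun _ => by positivity

/-- The logarithmic derivative of the damped exponential is `damping ε t`, at most `1`, so damping
never increases the `∇ρ` part of the energy density. -/
theorem hasDerivAt_exp_mul_damping {ε : ℝ} (hε : 0 < ε) (t : ℝ) :
    HasDerivAt (fun t => Real.exp t * damping ε t) (Real.exp t * damping ε t ^ 2) t := by
  have h0 : 1 + ε * Real.exp t ≠ 0 := by positivity
  have h := (Real.hasDerivAt_exp t).mul
    ((((Real.hasDerivAt_exp t).const_mul ε).const_add 1).inv h0)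
  convert! h using 1
  simp only [damping, Pi.inv_apply]
  field_simp
  ring

/-- The trial function `e^{i⟪ξ, x⟫} e^ρ / (1 + ε e^ρ)`. -/
noncomputable def trialFunction (ε : ℝ) (ρ : EuclideanSpace ℝ (Fin ν) → ℝ)
    (ξ x : EuclideanSpace ℝ (Fin ν)) : ℂ :=
  ((Real.exp (ρ x) * damping ε (ρ x) : ℝ) : ℂ) * planeWave ξ x

/-- The gradient of `trialFunction ε ρ ξ`. -/
noncomputable def trialGradient (ε : ℝ) (ρ : EuclideanSpace ℝ (Fin ν) → ℝ)
    (ξ x : EuclideanSpace ℝ (Fin ν)) : EuclideanSpace ℂ (Fin ν) :=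
  WithLp.toLp 2 fun i => trialFunction ε ρ ξ x *
    (((damping ε (ρ x) * (∇ ρ x) i : ℝ) : ℂ) + (ξ i : ℂ) * I)

theorem norm_trialFunction {ε : ℝ} (hε : 0 < ε) (ρ : EuclideanSpace ℝ (Fin ν) → ℝ)
    (ξ x : EuclideanSpace ℝ (Fin ν)) :
    ‖trialFunction ε ρ ξ x‖ = Real.exp (ρ x) * damping ε (ρ x) := by
  rw [trialFunction, norm_mul, norm_planeWave, mul_one, norm_real,
    Real.norm_of_nonneg (mul_nonneg (Real.exp_nonneg _) (damping_pos hε _).le)]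

/-- There is no cross term: up to the common factor, `∇ρ` contributes the real part and `ξ` the
imaginary part. -/
theorem norm_trialGradient_sq {ε : ℝ} (hε : 0 < ε) (ρ : EuclideanSpace ℝ (Fin ν) → ℝ)
    (ξ x : EuclideanSpace ℝ (Fin ν)) :
    ‖trialGradient ε ρ ξ x‖ ^ 2 = (Real.exp (ρ x) * damping ε (ρ x)) ^ 2 *
      (damping ε (ρ x) ^ 2 * ‖∇ ρ x‖ ^ 2 + ‖ξ‖ ^ 2) := by
  rw [EuclideanSpace.norm_sq_eq, EuclideanSpace.norm_sq_eq, EuclideanSpace.norm_sq_eq,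
    Finset.mul_sum, ← Finset.sum_add_distrib, Finset.mul_sum]
  refine Finset.sum_congr rfl fun i _ => ?_
  simp only [trialGradient]
  rw [norm_mul, norm_trialFunction hε, mul_pow, ← Complex.normSq_eq_norm_sq (_ + _),
    Complex.normSq_add_mul_I, mul_pow (damping _ _), Real.norm_eq_abs, Real.norm_eq_abs, sq_abs,
    sq_abs]

theorem hasLineDerivAt_trialFunction {ε : ℝ} (hε : 0 < ε) {ρ : EuclideanSpace ℝ (Fin ν) → ℝ}
    {x : EuclideanSpace ℝ (Fin ν)} (hρ : DifferentiableAt ℝ ρ x) (ξ : EuclideanSpace ℝ (Fin ν))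
    (i : Fin ν) :
    HasLineDerivAt ℝ (trialFunction ε ρ ξ) (trialGradient ε ρ ξ x i) x
      (EuclideanSpace.single i 1) := by
  set v : EuclideanSpace ℝ (Fin ν) := EuclideanSpace.single i 1
  have hρ' : HasDerivAt (fun t : ℝ => ρ (x + t • v)) ((∇ ρ x) i) 0 := by
    have h := hρ.hasGradientAt.hasFDerivAt.hasLineDerivAt v
    have hv : InnerProductSpace.toDual ℝ _ (∇ ρ x) v = (∇ ρ x) i := by
      rw [InnerProductSpace.toDual_apply_apply, EuclideanSpace.inner_single_right]
      simp
    rwa [hv] at h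
  have h1 : HasDerivAt (fun t : ℝ => ((inner ℝ ξ (x + t • v) : ℝ) : ℂ) * I) (ξ i * I) 0 := by
    have : HasDerivAt (fun t : ℝ => inner ℝ ξ (x + t • v)) (ξ i) 0 := by
      have h : ∀ t : ℝ, inner ℝ ξ (x + t • v) = inner ℝ ξ x + t * ξ i := by
        intro t
        simp [v, inner_add_right, inner_smul_right, EuclideanSpace.inner_single_right]
      simp only [h]
      simpa using ((hasDerivAt_id (0 : ℝ)).mul_const (ξ i)).const_add (inner ℝ ξ x)
    exact this.ofReal_comp.mul_const I
  have h2 := ((hasDerivAt_exp_mul_damping hε (ρ (x + (0 : ℝ) • v))).comp (0 : ℝ) hρ').ofReal_comp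
  have h3 := h2.mul h1.cexp
  unfold HasLineDerivAt
  convert! h3 using 1
  simp only [trialGradient, trialFunction, planeWave, zero_smul, add_zero, Function.comp]
  push_cast
  ring

section Continuity

variable {Ω : Set (EuclideanSpace ℝ (Fin ν))} {ρ : EuclideanSpace ℝ (Fin ν) → ℝ} {ε : ℝ}

theorem continuousOn_gradient (hΩ : IsOpen Ω) (hρ : ContDiffOn ℝ 1 ρ Ω) :
    ContinuousOn (fun x => ∇ ρ x) Ω :=
  (InnerProductSpace.toDual ℝ _).symm.continuous.comp_continuousOn
    (hρ.continuousOn_fderiv_of_isOpen hΩ le_rfl)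

theorem continuousOn_damping (hε : 0 < ε) (hρ : ContinuousOn ρ Ω) :
    ContinuousOn (fun x => damping ε (ρ x)) Ω :=
  (continuous_damping hε).comp_continuousOn hρ

theorem continuousOn_trialFunction (hε : 0 < ε) (hρ : ContinuousOn ρ Ω)
    (ξ : EuclideanSpace ℝ (Fin ν)) : ContinuousOn (trialFunction ε ρ ξ) Ω :=
  (continuous_ofReal.comp_continuousOn ((Real.continuous_exp.comp_continuousOn hρ).mul
    (continuousOn_damping hε hρ))).mul (continuous_planeWave ξ).continuousOn

theorem continuousOn_trialGradient (hε : 0 < ε) (hΩ : IsOpen Ω) (hρ : ContDiffOn ℝ 1 ρ Ω)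
    (ξ : EuclideanSpace ℝ (Fin ν)) : ContinuousOn (trialGradient ε ρ ξ) Ω := by
  refine (PiLp.continuous_toLp 2 _).comp_continuousOn (continuousOn_pi.2 fun i => ?_)
  have h1 : ContinuousOn (fun x => (∇ ρ x) i) Ω :=
    (EuclideanSpace.proj (𝕜 := ℝ) i).continuous.comp_continuousOn (continuousOn_gradient hΩ hρ)
  exact (continuousOn_trialFunction hε hρ.continuousOn ξ).mul
    ((continuous_ofReal.comp_continuousOn ((continuousOn_damping hε hρ.continuousOn).mul h1)).add
      continuousOn_const)

end Continuity

section Integrability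

variable {Ω : Set (EuclideanSpace ℝ (Fin ν))} {ρ w : EuclideanSpace ℝ (Fin ν) → ℝ} {ε : ℝ}

theorem integrableOn_bounded_mul (hΩ : MeasurableSet Ω) {f g : EuclideanSpace ℝ (Fin ν) → ℝ}
    (hf : ContinuousOn f Ω) {M : ℝ} (hM : ∀ x ∈ Ω, |f x| ≤ M) (hg : IntegrableOn g Ω) :
    IntegrableOn (fun x => f x * g x) Ω :=
  Integrable.bdd_mul (c := M) hg (hf.aestronglyMeasurable hΩ)
    ((ae_restrict_iff' hΩ).2 (Filter.Eventually.of_forall hM))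

theorem abs_damping_pow_le_one (hε : 0 < ε) (t : ℝ) (p : ℕ) : |damping ε t ^ p| ≤ 1 := by
  rw [abs_of_nonneg (pow_nonneg (damping_pos hε _).le _)]
  exact pow_le_one₀ (damping_pos hε _).le (damping_le_one hε _)

theorem integrableOn_damping_pow_mul (hε : 0 < ε) (hΩ : MeasurableSet Ω) (hρ : ContinuousOn ρ Ω)
    (p : ℕ) {g : EuclideanSpace ℝ (Fin ν) → ℝ} (hg : IntegrableOn g Ω) :
    IntegrableOn (fun x => damping ε (ρ x) ^ p * g x) Ω :=
  integrableOn_bounded_mul hΩ ((continuousOn_damping hε hρ).pow p)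
    (fun _ _ => abs_damping_pow_le_one hε _ p) hg

theorem integrableOn_damping_sq (hε : 0 < ε) (hΩ : MeasurableSet Ω) (hΩ' : volume Ω ≠ ⊤)
    (hρ : ContinuousOn ρ Ω) : IntegrableOn (fun x => damping ε (ρ x) ^ 2) Ω := by
  simpa using integrableOn_damping_pow_mul hε hΩ hρ 2 (integrableOn_const (C := (1 : ℝ)) hΩ')

/-- The weight cancels `e^{2ρ}`, so every trial function has the same norm, whatever its frequency.
-/
theorem norm_trialFunction_sq_mul_exp (hε : 0 < ε) (ξ x : EuclideanSpace ℝ (Fin ν)) :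
    ‖trialFunction ε ρ ξ x‖ ^ 2 * Real.exp (-2 * ρ x) = damping ε (ρ x) ^ 2 := by
  have h : Real.exp (ρ x) ^ 2 * Real.exp (-2 * ρ x) = 1 := by
    rw [← Real.exp_nat_mul, ← Real.exp_add]
    simp
  rw [norm_trialFunction hε, mul_pow, mul_right_comm, h, one_mul]

theorem norm_trialGradient_sq_mul_exp (hε : 0 < ε) (ξ x : EuclideanSpace ℝ (Fin ν)) :
    ‖trialGradient ε ρ ξ x‖ ^ 2 * Real.exp (-2 * ρ x) =
      damping ε (ρ x) ^ 4 * ‖∇ ρ x‖ ^ 2 + damping ε (ρ x) ^ 2 * ‖ξ‖ ^ 2 := by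
  rw [norm_trialGradient_sq hε, mul_right_comm, ← norm_trialFunction hε ρ ξ,
    norm_trialFunction_sq_mul_exp hε]
  ring

theorem memLp_trialFunction (hε : 0 < ε) (hΩ : MeasurableSet Ω) (hΩ' : volume Ω ≠ ⊤)
    (hρ : ContinuousOn ρ Ω) (ξ : EuclideanSpace ℝ (Fin ν)) :
    MemLp (trialFunction ε ρ ξ) 2 (volume.restrict Ω) := by
  have : IsFiniteMeasure (volume.restrict Ω) := isFiniteMeasure_restrict.2 hΩ'
  refine MemLp.of_bound ((continuousOn_trialFunction hε hρ ξ).aestronglyMeasurable hΩ) ε⁻¹ ?_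
  refine Filter.Eventually.of_forall fun x => ?_
  rw [norm_trialFunction hε]
  exact exp_mul_damping_le hε _

/-- Membership in `H¹(Ω)` refers to Lebesgue measure, hence the unweighted hypothesis on `∇ρ`. -/
theorem memLp_trialGradient (hε : 0 < ε) (hΩ : IsOpen Ω) (hΩ' : volume Ω ≠ ⊤)
    (hρ : ContDiffOn ℝ 1 ρ Ω) (hgrad : IntegrableOn (fun x => ‖∇ ρ x‖ ^ 2) Ω)
    (ξ : EuclideanSpace ℝ (Fin ν)) :
    MemLp (trialGradient ε ρ ξ) 2 (volume.restrict Ω) := by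
  have hmeas := (continuousOn_trialGradient hε hΩ hρ ξ).aestronglyMeasurable
    (μ := volume) hΩ.measurableSet
  rw [memLp_two_iff_integrable_sq_norm hmeas]
  refine Integrable.mono' (g := fun x => ε⁻¹ ^ 2 * (‖∇ ρ x‖ ^ 2 + ‖ξ‖ ^ 2))
    ((hgrad.add (integrableOn_const hΩ')).const_mul _) (hmeas.norm.pow 2)
    (Filter.Eventually.of_forall fun x => ?_)
  rw [Real.norm_of_nonneg (sq_nonneg _), norm_trialGradient_sq hε]
  have h1 := exp_mul_damping_le hε (ρ x)
  have h2 := (damping_pos hε (ρ x)).le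
  have h3 := damping_le_one hε (ρ x)
  gcongr
  exact mul_le_of_le_one_left (sq_nonneg _) (pow_le_one₀ h2 h3)

/-- The square root of the energy density weight `w e^{-2ρ}`. -/
noncomputable def sqrtWeight (ρ w : EuclideanSpace ℝ (Fin ν) → ℝ) (x : EuclideanSpace ℝ (Fin ν)) :
    ℝ :=
  √(w x) * Real.exp (-ρ x)

theorem sqrtWeight_sq {x : EuclideanSpace ℝ (Fin ν)} (hw : 0 ≤ w x) :
    sqrtWeight ρ w x ^ 2 = w x * Real.exp (-2 * ρ x) := by
  rw [sqrtWeight, mul_pow, Real.sq_sqrt hw, ← Real.exp_nat_mul]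
  congr 2
  push_cast
  ring

theorem norm_sqrtWeight_smul_sq {E : Type*} [NormedAddCommGroup E] [NormedSpace ℝ E] (v : E)
    {x : EuclideanSpace ℝ (Fin ν)} (hw : 0 ≤ w x) :
    ‖sqrtWeight ρ w x • v‖ ^ 2 = ‖v‖ ^ 2 * w x * Real.exp (-2 * ρ x) := by
  rw [norm_smul, mul_pow, Real.norm_eq_abs, sq_abs, sqrtWeight_sq hw]
  ring

theorem continuousOn_sqrtWeight (hρ : ContinuousOn ρ Ω) (hw : ContinuousOn w Ω) :
    ContinuousOn (sqrtWeight ρ w) Ω :=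
  hw.sqrt.mul (Real.continuous_exp.comp_continuousOn hρ.neg)

theorem memLp_sqrtWeight_smul_trialFunction (hε : 0 < ε) (hΩ : MeasurableSet Ω)
    (hρ : ContinuousOn ρ Ω) (hw : ContinuousOn w Ω) (hw0 : ∀ x ∈ Ω, 0 ≤ w x)
    (hwi : IntegrableOn w Ω) (ξ : EuclideanSpace ℝ (Fin ν)) :
    MemLp (fun x => sqrtWeight ρ w x • trialFunction ε ρ ξ x) 2 (volume.restrict Ω) := by
  have hmeas : AEStronglyMeasurable (fun x => sqrtWeight ρ w x • trialFunction ε ρ ξ x)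
      (volume.restrict Ω) :=
    ((continuousOn_sqrtWeight hρ hw).smul
      (continuousOn_trialFunction hε hρ ξ)).aestronglyMeasurable hΩ
  rw [memLp_two_iff_integrable_sq_norm hmeas]
  refine IntegrableOn.congr_fun (integrableOn_damping_pow_mul hε hΩ hρ 2 hwi) (fun x hx => ?_) hΩ
  rw [norm_sqrtWeight_smul_sq _ (hw0 x hx), ← norm_trialFunction_sq_mul_exp hε ξ]
  ring

theorem memLp_sqrtWeight_smul_trialGradient (hε : 0 < ε) (hΩ : IsOpen Ω)
    (hρ : ContDiffOn ℝ 1 ρ Ω) (hw : ContinuousOn w Ω) (hw0 : ∀ x ∈ Ω, 0 ≤ w x)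
    (hwi : IntegrableOn w Ω) (hgrad : IntegrableOn (fun x => ‖∇ ρ x‖ ^ 2 * w x) Ω)
    (ξ : EuclideanSpace ℝ (Fin ν)) :
    MemLp (fun x => sqrtWeight ρ w x • trialGradient ε ρ ξ x) 2 (volume.restrict Ω) := by
  have hmeas : AEStronglyMeasurable (fun x => sqrtWeight ρ w x • trialGradient ε ρ ξ x)
      (volume.restrict Ω) :=
    ((continuousOn_sqrtWeight hρ.continuousOn hw).smul
      (continuousOn_trialGradient hε hΩ hρ ξ)).aestronglyMeasurable hΩ.measurableSet
  rw [memLp_two_iff_integrable_sq_norm hmeas]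
  have h1 := (integrableOn_damping_pow_mul hε hΩ.measurableSet hρ.continuousOn 4 hgrad).add
    ((integrableOn_damping_pow_mul hε hΩ.measurableSet hρ.continuousOn 2 hwi).mul_const (‖ξ‖ ^ 2))
  refine IntegrableOn.congr_fun h1 (fun x hx => ?_) hΩ.measurableSet
  rw [norm_sqrtWeight_smul_sq _ (hw0 x hx), mul_right_comm, norm_trialGradient_sq_mul_exp hε,
    Pi.add_apply]
  ring

end Integrability

end TrialFunctions

/-! ### The eigenvalue bound for finitely many frequencies -/

section LatticeBound

open Complex

variable {ν : ℕ} {Ω : Set (EuclideanSpace ℝ (Fin ν))} {ρ w V : EuclideanSpace ℝ (Fin ν) → ℝ}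

/-- The linear combinations of a finite family of square integrable functions. -/
noncomputable def lpCombination {X ι : Type*} [MeasurableSpace X] {μ : Measure X} [Fintype ι]
    {f : ι → X → ℂ} (hf : ∀ i, MemLp (f i) 2 μ) : (ι → ℂ) →ₗ[ℂ] Lp ℂ 2 μ :=
  Fintype.linearCombination ℂ fun i => (hf i).toLp (f i)

theorem lpCombination_apply_ae {X ι : Type*} [MeasurableSpace X] {μ : Measure X} [Fintype ι]
    {f : ι → X → ℂ} (hf : ∀ i, MemLp (f i) 2 μ) (a : ι → ℂ) :
    lpCombination hf a =ᵐ[μ] fun x => ∑ i, a i • f i x := by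
  have h1 : lpCombination hf a = ∑ i, a i • (hf i).toLp (f i) := rfl
  rw [h1]
  refine (Lp.coeFn_finsetSum _ _).trans ?_
  have h2 : ∀ᵐ x ∂μ, ∀ i, (a i • (hf i).toLp (f i) : Lp ℂ 2 μ) x = a i • f i x := by
    rw [ae_all_iff]
    intro i
    filter_upwards [Lp.coeFn_smul (a i) ((hf i).toLp (f i)), (hf i).coeFn_toLp] with x h3 h4
    rw [h3, Pi.smul_apply, h4]
  filter_upwards [h2] with x hx
  simp [hx]

theorem isWeakGradient_sum_trial (hΩ : IsOpen Ω) (hρ : ContDiffOn ℝ 1 ρ Ω) {ε : ℝ} (hε : 0 < ε)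
    {ι : Type*} [Fintype ι] (ξ : ι → EuclideanSpace ℝ (Fin ν)) (a : ι → ℂ) :
    IsWeakGradient Ω (fun x => ∑ i, a i • trialFunction ε ρ (ξ i) x)
      (fun x => ∑ i, a i • trialGradient ε ρ (ξ i) x) := by
  refine isWeakGradient_of_hasLineDerivAt hΩ
    (continuousOn_finsetSum _ fun i _ =>
      (continuousOn_trialFunction hε hρ.continuousOn (ξ i)).const_smul (a i))
    (continuousOn_finsetSum _ fun i _ =>
      (continuousOn_trialGradient hε hΩ hρ (ξ i)).const_smul (a i)) fun x hx j => ?_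
  have h := HasDerivAt.fun_sum (u := Finset.univ) fun i _ =>
    (hasLineDerivAt_trialFunction hε
      ((hρ.contDiffAt (hΩ.mem_nhds hx)).differentiableAt one_ne_zero) (ξ i) j).const_smul (a i)
  unfold HasLineDerivAt
  convert! h using 1
  simp

/-- The averaged principle with `c = n^ν`: `hcard` says that the total squared norm of the trial
functions is at least `k c`. -/
theorem sum_neumannEigenvalue_le_of_lattice (hΩ : IsOpen Ω) (hΩ_fin : volume Ω ≠ ⊤)
    (hΩ_ne : Ω.Nonempty)
    (hρ : ContDiffOn ℝ 1 ρ Ω) (hw : ContinuousOn w Ω) (hw0 : ∀ x ∈ Ω, 0 ≤ w x)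
    (hV : ContinuousOn V Ω) {M : ℝ} (hVM : ∀ x ∈ Ω, |V x| ≤ M) (hw_int : IntegrableOn w Ω)
    (hgrad : IntegrableOn (fun x => ‖∇ ρ x‖ ^ 2) Ω)
    (hgradw : IntegrableOn (fun x => ‖∇ ρ x‖ ^ 2 * w x) Ω)
    {ε : ℝ} (hε : 0 < ε) {n : ℕ} (hn : n ≠ 0) (hΩn : Ω ⊆ centeredCube ν n)
    {ι : Type*} [Fintype ι] {m : ι → Fin ν → ℤ} (hm : Function.Injective m) {k : ℕ} (hk : 1 ≤ k)
    (hcard : k * (n : ℝ) ^ ν ≤ Fintype.card ι * ∫ x in Ω, damping ε (ρ x) ^ 2) :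
    ∑ j ∈ Finset.range k, neumannEigenvalue Ω ρ w V j ≤
      ((k * (∑ i, ∫ x in Ω, (damping ε (ρ x) ^ 4 * ‖∇ ρ x‖ ^ 2 +
          damping ε (ρ x) ^ 2 * ‖(2 * Real.pi) • latticePoint n (m i)‖ ^ 2 +
          damping ε (ρ x) ^ 2 * V x) * w x) /
        (Fintype.card ι * ∫ x in Ω, damping ε (ρ x) ^ 2) : ℝ) : EReal) := by
  classical
  have hΩm := hΩ.measurableSet
  have hρc := hρ.continuousOn
  set ξ : ι → EuclideanSpace ℝ (Fin ν) := fun i => (2 * Real.pi) • latticePoint n (m i)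
  have : IsFiniteMeasure (volume.restrict Ω) := isFiniteMeasure_restrict.2 hΩ_fin
  have hac := restrict_absolutelyContinuous_weightedMeasure hΩm hρc
  have hmem : ∀ i, MemLp (trialFunction ε ρ (ξ i)) 2 (weightedMeasure Ω ρ) := fun i =>
    memLp_weightedMeasure hΩm hρc (continuousOn_trialFunction hε hρc _)
      (by simpa only [norm_trialFunction_sq_mul_exp hε] using
        integrableOn_damping_sq hε hΩm hΩ_fin hρc)
  set T := lpCombination hmem
  have hT_ae : ∀ a, T a =ᵐ[volume.restrict Ω] fun x => ∑ i, a i • trialFunction ε ρ (ξ i) x :=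
    fun a => hac.ae_le (lpCombination_apply_ae hmem a)
  have hsum : ∀ (a : ι → ℂ) x, ∑ i, a i • trialFunction ε ρ (ξ i) x =
      ((Real.exp (ρ x) * damping ε (ρ x) : ℝ) : ℂ) * ∑ i, a i * planeWave (ξ i) x := by
    intro a x
    rw [Finset.mul_sum]
    refine Finset.sum_congr rfl fun i _ => ?_
    rw [smul_eq_mul, trialFunction]
    ring
  have hTnorm : ∀ a, ‖T a‖ ^ 2 =
      ∫ x in Ω, damping ε (ρ x) ^ 2 * ‖∑ i, a i * planeWave (ξ i) x‖ ^ 2 := by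
    intro a
    rw [WeightedL2.norm_sq_eq hΩm hρc]
    refine integral_congr_ae ?_
    filter_upwards [hT_ae a] with x hx
    rw [hx, hsum, norm_mul, mul_pow, mul_right_comm, ← norm_trialFunction_sq_mul_exp hε 0,
      norm_trialFunction hε, norm_real, Real.norm_eq_abs, sq_abs]
  have hTsingle : ∀ i, ‖T (Pi.single i 1)‖ ^ 2 = ∫ x in Ω, damping ε (ρ x) ^ 2 := by
    intro i
    rw [hTnorm]
    refine integral_congr_ae (Filter.Eventually.of_forall fun x => ?_)
    simp [Pi.single_apply, norm_planeWave]
  have hT_inj : Function.Injective T := by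
    rw [injective_iff_map_eq_zero]
    intro a ha
    have h1 : ∀ᵐ x ∂volume.restrict Ω, ∑ i, a i * planeWave (ξ i) x = 0 := by
      have h0 := hT_ae a
      rw [ha] at h0
      filter_upwards [h0, hac.ae_le (Lp.coeFn_zero ℂ 2 (weightedMeasure Ω ρ))] with x h2 h3
      rw [h3, Pi.zero_apply, hsum] at h2
      refine (mul_eq_zero.1 h2.symm).resolve_left ?_
      exact ofReal_ne_zero.2 (mul_pos (Real.exp_pos _) (damping_pos hε _)).ne'
    have hcont : Continuous fun x => ∑ i, a i * planeWave (ξ i) x :=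
      continuous_finsetSum _ fun i _ => continuous_const.mul (continuous_planeWave _)
    exact eq_zero_of_sum_planeWave_eq_zero hΩ hΩ_ne hn hm
      (Measure.eqOn_open_of_ae_eq h1 hΩ hcont.continuousOn continuousOn_const)
  -- Drop the damping, which is at most `1`, enlarge `Ω` to the cube and apply Parseval.
  have hbound : ∀ a, ‖T a‖ ^ 2 ≤ (n : ℝ) ^ ν * ∑ i, ‖a i‖ ^ 2 := by
    intro a
    have hcont : Continuous fun x => ‖∑ i, a i * planeWave (ξ i) x‖ ^ 2 :=
      (continuous_finsetSum _ fun i _ =>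
        continuous_const.mul (continuous_planeWave _)).norm.pow 2
    have hintQ : IntegrableOn (fun x => ‖∑ i, a i * planeWave (ξ i) x‖ ^ 2) (centeredCube ν n) :=
      (hcont.continuousOn.integrableOn_compact
        (isBounded_centeredCube ν n).isCompact_closure).mono_set subset_closure
    rw [hTnorm, ← setIntegral_centeredCube_norm_sum_sq hn hm a]
    calc ∫ x in Ω, damping ε (ρ x) ^ 2 * ‖∑ i, a i * planeWave (ξ i) x‖ ^ 2
        ≤ ∫ x in Ω, ‖∑ i, a i * planeWave (ξ i) x‖ ^ 2 := by
          refine integral_mono (integrableOn_damping_pow_mul hε hΩm hρc 2 (hintQ.mono_set hΩn))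
            (hintQ.mono_set hΩn) fun x => ?_
          exact mul_le_of_le_one_left (sq_nonneg _)
            ((le_abs_self _).trans (abs_damping_pow_le_one hε _ 2))
      _ ≤ _ := setIntegral_mono_set hintQ (Filter.Eventually.of_forall fun x => sq_nonneg _)
          (Filter.Eventually.of_forall hΩn)
  have hnν : (0 : ℝ) < (n : ℝ) ^ ν := pow_pos (by exact_mod_cast Nat.pos_of_ne_zero hn) _
  have hk0 : (0 : ℝ) < k := by exact_mod_cast hk
  -- With the square root of `w e^{-2ρ}` absorbed into the functions, the energy is a form on `L²(Ω,
  -- dx)` with bounded coefficient `V`.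
  set u : ι → EuclideanSpace ℝ (Fin ν) → EuclideanSpace ℂ (Fin ν) :=
    fun i x => sqrtWeight ρ w x • trialGradient ε ρ (ξ i) x
  set p : ι → EuclideanSpace ℝ (Fin ν) → ℂ :=
    fun i x => sqrtWeight ρ w x • trialFunction ε ρ (ξ i) x
  have hu : ∀ i, MemLp (u i) 2 (volume.restrict Ω) := fun i =>
    memLp_sqrtWeight_smul_trialGradient hε hΩ hρ hw hw0 hw_int hgradw (ξ i)
  have hp : ∀ i, MemLp (p i) 2 (volume.restrict Ω) := fun i =>
    memLp_sqrtWeight_smul_trialFunction hε hΩm hρc hw hw0 hw_int (ξ i)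
  have hVae : ∀ᵐ x ∂volume.restrict Ω, ‖V x‖ ≤ M :=
    (ae_restrict_iff' hΩm).2 (Filter.Eventually.of_forall hVM)
  obtain ⟨l, hl1, hl2⟩ :=
    (isHermitian_energyMatrix (μ := volume.restrict Ω) V u p).exists_subspaces_sum_le T hT_inj hnν
      hbound hk (by simpa [hTsingle] using hcard)
  have hle : ∀ j ∈ Finset.range k, neumannEigenvalue Ω ρ w V j ≤ l j := by
    intro j hj
    obtain ⟨W, hW, hWl⟩ := hl1 j (Finset.mem_range.1 hj)
    refine neumannEigenvalue_le (W.map T) ?_ ?_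
    · rw [← hW]
      exact (Submodule.equivMapOfInjective T hT_inj W).finrank_eq.symm
    rintro _ ⟨a, ha, rfl⟩ h1
    set G : EuclideanSpace ℝ (Fin ν) → EuclideanSpace ℂ (Fin ν) :=
      fun x => ∑ i, a i • trialGradient ε ρ (ξ i) x
    have hφmem : MemLp (fun x => ∑ i, a i • trialFunction ε ρ (ξ i) x) 2 (volume.restrict Ω) :=
      memLp_finsetSum _ fun i _ => (memLp_trialFunction hε hΩm hΩ_fin hρc (ξ i)).const_smul (a i)
    have hTmem : MemLp (T a) 2 (volume.restrict Ω) := hφmem.ae_eq (hT_ae a).symm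
    have hGu : ∀ x ∈ Ω, ‖G x‖ ^ 2 * w x * Real.exp (-2 * ρ x) = ‖∑ i, a i • u i x‖ ^ 2 := by
      intro x hx
      rw [← norm_sqrtWeight_smul_sq _ (hw0 x hx)]
      simp only [G, u, Finset.smul_sum, smul_comm (sqrtWeight ρ w x)]
    have hφp : ∀ᵐ x ∂volume.restrict Ω,
        ‖T a x‖ ^ 2 * w x * Real.exp (-2 * ρ x) = ‖∑ i, a i • p i x‖ ^ 2 := by
      filter_upwards [hT_ae a, ae_restrict_mem hΩm] with x h2 hx
      rw [← norm_sqrtWeight_smul_sq _ (hw0 x hx), h2]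
      simp only [p, Finset.smul_sum, smul_comm (sqrtWeight ρ w x)]
    refine ⟨G, ⟨⟨hTmem, ?_, ?_⟩, ?_, ?_⟩, ?_⟩
    · exact memLp_finsetSum _ fun i _ =>
        (memLp_trialGradient hε hΩ hΩ_fin hρ hgrad (ξ i)).const_smul (a i)
    · exact (isWeakGradient_sum_trial hΩ hρ hε ξ a).congr_ae
        (hTmem.integrable one_le_two) (hT_ae a).symm
    · refine IntegrableOn.congr_fun ?_ (fun x hx => (hGu x hx).symm) hΩm
      exact (memLp_finsetSum Finset.univ fun i _ =>
        (hu i).const_smul (a i)).integrable_norm_pow two_ne_zero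
    · have h2 := integrableOn_bounded_mul hΩm hV hVM
        ((memLp_finsetSum Finset.univ fun i _ =>
          (hp i).const_smul (a i)).integrable_norm_pow two_ne_zero)
      refine Integrable.congr h2 ?_
      filter_upwards [hφp] with x hx
      simp only [Pi.smul_apply]
      rw [← hx]
      ring
    · rw [rayleighQuotient, ← WeightedL2.norm_sq_eq hΩm hρc, h1, one_pow, div_one]
      have h2 := hWl a ha
      rw [h1, one_pow, mul_one, star_dotProduct_energyMatrix_mulVec
        (hV.aestronglyMeasurable hΩm) hVae hu hp] at h2
      refine le_of_eq_of_le (integral_congr_ae ?_) h2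
      filter_upwards [hφp, ae_restrict_mem hΩm] with x h3 hx
      rw [← hGu x hx, ← h3]
      ring
  refine (Finset.sum_le_sum hle).trans ?_
  have hcoe : ∑ j ∈ Finset.range k, (l j : EReal) = ((∑ j ∈ Finset.range k, l j : ℝ) : EReal) :=
    by
    induction Finset.range k using Finset.induction_on with
    | empty => simp
    | insert j s hj ih => rw [Finset.sum_insert hj, Finset.sum_insert hj, ih, EReal.coe_add]
  rw [hcoe, EReal.coe_le_coe_iff, le_div_iff₀ ((mul_pos hk0 hnν).trans_le hcard)]
  simp only [hTsingle, Finset.sum_const, Finset.card_univ, nsmul_eq_mul] at hl2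
  refine hl2.trans_eq ?_
  congr 1
  refine Finset.sum_congr rfl fun i _ => ?_
  rw [energyMatrix_apply_self]
  refine setIntegral_congr_fun hΩm fun x hx => ?_
  simp only [u, p]
  rw [norm_sqrtWeight_smul_sq _ (hw0 x hx), norm_sqrtWeight_smul_sq _ (hw0 x hx),
    mul_right_comm, norm_trialGradient_sq_mul_exp hε, mul_right_comm,
    norm_trialFunction_sq_mul_exp hε]
  ring

end LatticeBound

/-! ### The limits `n → ∞` and `ε → 0` -/

section Limits

open Filter Topology

variable {ν : ℕ} {Ω : Set (EuclideanSpace ℝ (Fin ν))} {ρ w V : EuclideanSpace ℝ (Fin ν) → ℝ}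

theorem tendsto_card_latticeBall (ν : ℕ) {r : ℝ} (hr : 0 < r) :
    Tendsto (fun n : ℕ => (Nat.card (LatticeBall ν n r) : ℝ) / (n : ℝ) ^ ν) atTop
      (𝓝 (volume.real (Metric.ball (0 : EuclideanSpace ℝ (Fin ν)) 1) * r ^ ν)) := by
  have h := tendsto_tsum_latticeBall (ν := ν) (F := fun _ => 1) continuous_const r
  rw [setIntegral_const, smul_eq_mul, mul_one, measureReal_def, Measure.addHaar_ball_of_pos _ _ hr,
    finrank_euclideanSpace_fin, ENNReal.toReal_mul, ENNReal.toReal_ofReal (by positivity),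
    mul_comm, ← measureReal_def] at h
  refine h.congr fun n => ?_
  rw [tsum_const, nsmul_eq_mul, mul_one]

theorem eventually_subset_centeredCube (hΩ : Bornology.IsBounded Ω) :
    ∀ᶠ n : ℕ in atTop, Ω ⊆ centeredCube ν n := by
  obtain ⟨R, hR⟩ := hΩ.exists_norm_le
  obtain ⟨N, hN⟩ := exists_nat_gt (2 * R)
  filter_upwards [eventually_ge_atTop N] with n hn x hx i
  have h1 : |x i| ≤ R := (PiLp.norm_apply_le x i).trans (hR x hx)
  have h2 : (N : ℝ) ≤ n := by exact_mod_cast hn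
  rw [abs_le] at h1
  constructor <;> linarith

theorem tendsto_setIntegral_damping_pow_mul (hΩ : MeasurableSet Ω) (hρ : ContinuousOn ρ Ω) (p : ℕ)
    {g : EuclideanSpace ℝ (Fin ν) → ℝ} (hg : IntegrableOn g Ω) :
    Tendsto (fun ε => ∫ x in Ω, damping ε (ρ x) ^ p * g x) (𝓝[>] 0) (𝓝 (∫ x in Ω, g x)) := by
  refine tendsto_integral_filter_of_dominated_convergence (fun x => |g x|) ?_ ?_ hg.abs ?_
  · filter_upwards [self_mem_nhdsWithin] with ε hε
    exact (integrableOn_damping_pow_mul hε hΩ hρ p hg).aestronglyMeasurable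
  · filter_upwards [self_mem_nhdsWithin] with ε hε
    refine Eventually.of_forall fun x => ?_
    rw [norm_mul]
    exact mul_le_of_le_one_left (abs_nonneg _) (abs_damping_pow_le_one hε _ p)
  · refine Eventually.of_forall fun x => ?_
    have h : ContinuousAt (fun ε : ℝ => damping ε (ρ x) ^ p * g x) 0 := by
      have : ContinuousAt (fun ε : ℝ => damping ε (ρ x)) 0 :=
        (by fun_prop : ContinuousAt (fun ε : ℝ => 1 + ε * Real.exp (ρ x)) 0).inv₀ (by simp)
      exact (this.pow p).mul continuousAt_const
    have h' := h.tendsto.mono_left (nhdsWithin_le_nhds (s := Set.Ioi 0))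
    simpa [damping] using h'

/-- The bound obtained from the frequencies of norm less than `2πr` and the damping `ε`. -/
theorem sum_neumannEigenvalue_le_damping (hν : 1 ≤ ν) (hΩ : IsOpen Ω)
    (hΩ_bdd : Bornology.IsBounded Ω) (hΩ_ne : Ω.Nonempty)
    (hρ : ContDiffOn ℝ 1 ρ Ω) (hw : ContinuousOn w Ω) (hw0 : ∀ x ∈ Ω, 0 ≤ w x)
    (hV : ContinuousOn V Ω) {M : ℝ} (hVM : ∀ x ∈ Ω, |V x| ≤ M) (hw_int : IntegrableOn w Ω)
    (hVw : IntegrableOn (fun x => V x * w x) Ω)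
    (hgrad : IntegrableOn (fun x => ‖∇ ρ x‖ ^ 2) Ω)
    (hgradw : IntegrableOn (fun x => ‖∇ ρ x‖ ^ 2 * w x) Ω)
    {ε : ℝ} (hε : 0 < ε) {k : ℕ} (hk : 1 ≤ k) {r : ℝ} (hr : 0 < r)
    (hkr : k < volume.real (Metric.ball (0 : EuclideanSpace ℝ (Fin ν)) 1) * r ^ ν *
      ∫ x in Ω, damping ε (ρ x) ^ 2) :
    ∑ j ∈ Finset.range k, neumannEigenvalue Ω ρ w V j ≤
      ((k * ((∫ x in Ω, damping ε (ρ x) ^ 4 * (‖∇ ρ x‖ ^ 2 * w x)) +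
          (∫ x in Ω, damping ε (ρ x) ^ 2 * (V x * w x)) +
          (2 * Real.pi) ^ 2 * (ν / (ν + 2) * r ^ 2) * ∫ x in Ω, damping ε (ρ x) ^ 2 * w x) /
        ∫ x in Ω, damping ε (ρ x) ^ 2 : ℝ) : EReal) := by
  have hΩm := hΩ.measurableSet
  have hρc := hρ.continuousOn
  set β := volume.real (Metric.ball (0 : EuclideanSpace ℝ (Fin ν)) 1)
  have hβ : 0 < β := ENNReal.toReal_pos (Metric.measure_ball_pos _ _ one_pos).ne'
    measure_ball_lt_top.ne
  set J := ∫ x in Ω, damping ε (ρ x) ^ 2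
  set A := ∫ x in Ω, damping ε (ρ x) ^ 4 * (‖∇ ρ x‖ ^ 2 * w x)
  set B := ∫ x in Ω, damping ε (ρ x) ^ 2 * (V x * w x)
  set D := ∫ x in Ω, damping ε (ρ x) ^ 2 * w x
  have hk0 : (0 : ℝ) < k := by exact_mod_cast hk
  have hr' : 0 < β * r ^ ν := by positivity
  have hJ : 0 < J := pos_of_mul_pos_right (hk0.trans hkr) hr'.le
  let S : ℕ → ℝ := fun n => ∑' m : LatticeBall ν n r, ‖latticePoint n m.1‖ ^ 2
  have hN := tendsto_card_latticeBall ν hr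
  have hS : Tendsto (fun n => S n / (n : ℝ) ^ ν) atTop
      (𝓝 (ν / (ν + 2) * β * r ^ (ν + 2))) := by
    have := tendsto_tsum_latticeBall (ν := ν) (F := fun x => ‖x‖ ^ 2) (by fun_prop) r
    rwa [setIntegral_ball_norm_sq hν hr.le] at this
  have hlim : Tendsto (fun n : ℕ => k * (A + B + (2 * Real.pi) ^ 2 *
      ((S n / (n : ℝ) ^ ν) / (Nat.card (LatticeBall ν n r) / (n : ℝ) ^ ν)) * D) / J) atTop
      (𝓝 (k * (A + B + (2 * Real.pi) ^ 2 * (ν / (ν + 2) * r ^ 2) * D) / J)) := by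
    -- The mean of `‖x‖²` over the ball of radius `r`: second moment divided by volume.
    have h1 : ν / (ν + 2) * r ^ 2 = (ν / (ν + 2) * β * r ^ (ν + 2)) / (β * r ^ ν) := by
      rw [pow_add]
      field_simp
    rw [h1]
    exact ((((hS.div hN hr'.ne').const_mul _).mul_const D).const_add (A + B)).const_mul
      (k : ℝ) |>.div_const J
  refine ge_of_tendsto ((continuous_coe_real_ereal.tendsto _).comp hlim) ?_
  -- The strict inequality `hkr` in the limit persists for large `n` and yields `hcard`.
  have hev : ∀ᶠ n : ℕ in atTop, k < (Nat.card (LatticeBall ν n r) / (n : ℝ) ^ ν) * J :=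
    (hN.mul_const J).eventually_const_lt hkr
  filter_upwards [hev, eventually_subset_centeredCube hΩ_bdd, eventually_ne_atTop 0]
    with n hn1 hn2 hn0
  have := finite_latticeBall ν hn0 r
  have := Fintype.ofFinite (LatticeBall ν n r)
  have hnν : (0 : ℝ) < (n : ℝ) ^ ν := pow_pos (by exact_mod_cast Nat.pos_of_ne_zero hn0) _
  rw [Nat.card_eq_fintype_card, div_mul_eq_mul_div, lt_div_iff₀ hnν] at hn1
  have key := sum_neumannEigenvalue_le_of_lattice hΩ hΩ_bdd.measure_lt_top.ne hΩ_ne hρ hw hw0 hV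
    hVM hw_int hgrad hgradw hε hn0 hn2 (m := fun m : LatticeBall ν n r => m.1)
    Subtype.val_injective hk hn1.le
  refine key.trans_eq ?_
  have hcard : (0 : ℝ) < Fintype.card (LatticeBall ν n r) :=
    pos_of_mul_pos_left ((mul_pos hk0 hnν).trans hn1) hJ.le
  have hint : ∀ m : LatticeBall ν n r, ∫ x in Ω, (damping ε (ρ x) ^ 4 * ‖∇ ρ x‖ ^ 2 +
      damping ε (ρ x) ^ 2 * ‖(2 * Real.pi) • latticePoint n m.1‖ ^ 2 +
      damping ε (ρ x) ^ 2 * V x) * w x =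
      A + B + (2 * Real.pi) ^ 2 * ‖latticePoint n m.1‖ ^ 2 * D := by
    intro m
    have hA := integrableOn_damping_pow_mul hε hΩm hρc 4 hgradw
    have hB := integrableOn_damping_pow_mul hε hΩm hρc 2 hVw
    have hD := integrableOn_damping_pow_mul hε hΩm hρc 2 hw_int
    have hAB : Integrable (fun x => damping ε (ρ x) ^ 4 * (‖∇ ρ x‖ ^ 2 * w x) +
      damping ε (ρ x) ^ 2 * (V x * w x)) (volume.restrict Ω) := hA.add hB
    rw [← integral_const_mul, ← integral_add hA hB, ← integral_add hAB (hD.const_mul _)]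
    refine integral_congr_ae (Eventually.of_forall fun x => ?_)
    simp only [norm_smul, mul_pow, Real.norm_eq_abs, sq_abs]
    ring
  have hS' : S n = ∑ m : LatticeBall ν n r, ‖latticePoint n m.1‖ ^ 2 := tsum_fintype _
  simp only [Function.comp, hint, Finset.sum_add_distrib, Finset.sum_const, Finset.card_univ,
    nsmul_eq_mul, ← Finset.sum_mul, ← Finset.mul_sum, ← hS', Nat.card_eq_fintype_card]
  congr 1
  change _ * (_ + _) / (_ * J) = _
  field_simp

/-- Dominated convergence as `ε → 0` removes the damping; strictness of `hkr` leaves room for small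
`ε`. -/
theorem sum_neumannEigenvalue_le_of_lt (hν : 1 ≤ ν) (hΩ : IsOpen Ω)
    (hΩ_bdd : Bornology.IsBounded Ω) (hΩ_ne : Ω.Nonempty)
    (hρ : ContDiffOn ℝ 1 ρ Ω) (hw : ContinuousOn w Ω) (hw0 : ∀ x ∈ Ω, 0 ≤ w x)
    (hV : ContinuousOn V Ω) {M : ℝ} (hVM : ∀ x ∈ Ω, |V x| ≤ M) (hw_int : IntegrableOn w Ω)
    (hVw : IntegrableOn (fun x => V x * w x) Ω)
    (hgrad : IntegrableOn (fun x => ‖∇ ρ x‖ ^ 2) Ω)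
    (hgradw : IntegrableOn (fun x => ‖∇ ρ x‖ ^ 2 * w x) Ω)
    {k : ℕ} (hk : 1 ≤ k) {r : ℝ} (hr : 0 < r)
    (hkr : k < volume.real (Metric.ball (0 : EuclideanSpace ℝ (Fin ν)) 1) * r ^ ν *
      volume.real Ω) :
    ∑ j ∈ Finset.range k, neumannEigenvalue Ω ρ w V j ≤
      ((k * ((∫ x in Ω, ‖∇ ρ x‖ ^ 2 * w x) + (∫ x in Ω, V x * w x) +
          (2 * Real.pi) ^ 2 * (ν / (ν + 2) * r ^ 2) * ∫ x in Ω, w x) / volume.real Ω : ℝ) :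
        EReal) := by
  have hΩm := hΩ.measurableSet
  have hρc := hρ.continuousOn
  have hvol : volume.real Ω ≠ 0 :=
    (ENNReal.toReal_pos (hΩ.measure_pos volume hΩ_ne).ne' hΩ_bdd.measure_lt_top.ne).ne'
  have hJ : Tendsto (fun ε => ∫ x in Ω, damping ε (ρ x) ^ 2) (𝓝[>] 0) (𝓝 (volume.real Ω)) := by
    simpa using tendsto_setIntegral_damping_pow_mul hΩm hρc 2
      (integrableOn_const (C := (1 : ℝ)) hΩ_bdd.measure_lt_top.ne)
  have hlim := (((((tendsto_setIntegral_damping_pow_mul hΩm hρc 4 hgradw).add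
    (tendsto_setIntegral_damping_pow_mul hΩm hρc 2 hVw)).add
    ((tendsto_setIntegral_damping_pow_mul hΩm hρc 2 hw_int).const_mul
      ((2 * Real.pi) ^ 2 * (ν / (ν + 2) * r ^ 2)))).const_mul (k : ℝ)).div hJ hvol)
  refine ge_of_tendsto ((continuous_coe_real_ereal.tendsto _).comp hlim) ?_
  filter_upwards [self_mem_nhdsWithin, (hJ.const_mul _).eventually_const_lt hkr] with ε hε hε'
  exact sum_neumannEigenvalue_le_damping hν hΩ hΩ_bdd hΩ_ne hρ hw hw0 hV hVM hw_int hVw hgrad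
    hgradw hε hk hr hε'

end Limits

/-! ### The optimal radius and the final bound -/

theorem mainTheorem12 (ν : ℕ) (hν : 1 ≤ ν)
    (Ω : Set (EuclideanSpace ℝ (Fin ν))) (hΩ_open : IsOpen Ω)
    (hΩ_bdd : Bornology.IsBounded Ω) (hΩ_ne : Ω.Nonempty)
    (ρ w V : EuclideanSpace ℝ (Fin ν) → ℝ)
    (hρ : ContDiffOn ℝ 1 ρ Ω)
    (hw : ContinuousOn w Ω) (hw_pos : ∃ C : ℝ, 0 < C ∧ ∀ x ∈ Ω, C ≤ w x)
    (hV : ∃ L : NNReal, LipschitzOnWith L V Ω)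
    (hw_int : IntegrableOn w Ω)
    (hVw_int : IntegrableOn (fun x => (V x + ‖∇ ρ x‖ ^ 2) * w x) Ω)
    (k : ℕ) (hk : 1 ≤ k) :
    ((1 / (k : ℝ) : ℝ) : EReal) * ∑ j ∈ Finset.range k, neumannEigenvalue Ω ρ w V j ≤
      ((4 * Real.pi ^ 2 * ν / (ν + 2) *
            ((k : ℝ) / (volume.real Ω *
              volume.real (Metric.ball (0 : EuclideanSpace ℝ (Fin ν)) 1))) ^ (2 / (ν : ℝ)) *
            (⨍ x in Ω, w x) +
          ⨍ x in Ω, (V x + ‖∇ ρ x‖ ^ 2) * w x : ℝ) : EReal) := by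
  obtain ⟨C, hC, hCw⟩ := hw_pos
  obtain ⟨L, hL⟩ := hV
  have hΩm := hΩ_open.measurableSet
  have hVc := hL.continuousOn
  have hw0 : ∀ x ∈ Ω, 0 ≤ w x := fun x hx => hC.le.trans (hCw x hx)
  obtain ⟨M, hVM⟩ : ∃ M, ∀ x ∈ Ω, |V x| ≤ M := by
    obtain ⟨x₀, hx₀⟩ := hΩ_ne
    refine ⟨|V x₀| + L * Metric.diam Ω, fun x hx => ?_⟩
    have h1 : |V x - V x₀| ≤ L * dist x x₀ := hL.dist_le_mul x hx x₀ hx₀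
    have h2 : L * dist x x₀ ≤ L * Metric.diam Ω :=
      mul_le_mul_of_nonneg_left (Metric.dist_le_diam_of_mem hΩ_bdd hx hx₀) L.2
    have h3 := abs_add_le (V x - V x₀) (V x₀)
    rw [sub_add_cancel] at h3
    linarith
  have hVw : IntegrableOn (fun x => V x * w x) Ω := integrableOn_bounded_mul hΩm hVc hVM hw_int
  have hgradw : IntegrableOn (fun x => ‖∇ ρ x‖ ^ 2 * w x) Ω := by
    refine (hVw_int.sub hVw).congr (Filter.Eventually.of_forall fun x => ?_)
    simp only [Pi.sub_apply]
    ring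
  -- The lower bound `C ≤ w` turns weighted integrability into unweighted integrability, as `H¹(Ω)`
  -- requires.
  have hgrad : IntegrableOn (fun x => ‖∇ ρ x‖ ^ 2) Ω := by
    refine Integrable.mono' (hgradw.const_mul C⁻¹)
      (((continuousOn_gradient hΩ_open hρ).norm.pow 2).aestronglyMeasurable hΩm) ?_
    refine (ae_restrict_iff' hΩm).2 (Filter.Eventually.of_forall fun x hx => ?_)
    rw [Real.norm_of_nonneg (sq_nonneg _), ← div_eq_inv_mul, le_div_iff₀ hC]
    exact mul_le_mul_of_nonneg_left (hCw x hx) (sq_nonneg _)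
  set β := volume.real (Metric.ball (0 : EuclideanSpace ℝ (Fin ν)) 1)
  have hβ : 0 < β := ENNReal.toReal_pos (Metric.measure_ball_pos _ _ one_pos).ne'
    measure_ball_lt_top.ne
  have hvol : 0 < volume.real Ω :=
    ENNReal.toReal_pos (hΩ_open.measure_pos volume hΩ_ne).ne' hΩ_bdd.measure_lt_top.ne
  have hk0 : (0 : ℝ) < k := by exact_mod_cast hk
  have hν0 : (ν : ℝ) ≠ 0 := by exact_mod_cast (by omega : ν ≠ 0)
  set q : ℝ := k / (volume.real Ω * β)
  have hq : 0 < q := by positivity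
  -- The critical radius, where `ω_ν r₀^ν |Ω| = k`.
  set r₀ : ℝ := q ^ (1 / (ν : ℝ))
  have hr₀ : 0 < r₀ := Real.rpow_pos_of_pos hq _
  have hr₀ν : r₀ ^ ν = q := by
    rw [← Real.rpow_natCast, ← Real.rpow_mul hq.le, one_div_mul_cancel hν0, Real.rpow_one]
  have hr₀2 : r₀ ^ 2 = q ^ (2 / (ν : ℝ)) := by
    rw [← Real.rpow_natCast, ← Real.rpow_mul hq.le]
    congr 1
    push_cast
    ring
  have hmain : ∑ j ∈ Finset.range k, neumannEigenvalue Ω ρ w V j ≤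
      ((k * ((∫ x in Ω, ‖∇ ρ x‖ ^ 2 * w x) + (∫ x in Ω, V x * w x) +
          (2 * Real.pi) ^ 2 * (ν / (ν + 2) * r₀ ^ 2) * ∫ x in Ω, w x) / volume.real Ω : ℝ) :
        EReal) := by
    have hcont : Continuous fun r : ℝ =>
        k * ((∫ x in Ω, ‖∇ ρ x‖ ^ 2 * w x) + (∫ x in Ω, V x * w x) +
          (2 * Real.pi) ^ 2 * (ν / (ν + 2) * r ^ 2) * ∫ x in Ω, w x) / volume.real Ω := by
      fun_prop
    -- The bound is known only for `r > r₀`; the right-hand side is continuous in `r`, so it extends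
    -- to `r₀`.
    refine ge_of_tendsto (((continuous_coe_real_ereal.comp hcont).tendsto r₀).mono_left
      (nhdsWithin_le_nhds (s := Set.Ioi r₀))) ?_
    filter_upwards [self_mem_nhdsWithin] with r hr
    refine sum_neumannEigenvalue_le_of_lt hν hΩ_open hΩ_bdd hΩ_ne hρ hw hw0 hVc hVM hw_int hVw
      hgrad hgradw hk (hr₀.trans hr) ?_
    have h1 : q < r ^ ν := by
      rw [← hr₀ν]
      exact pow_lt_pow_left₀ hr hr₀.le (by omega)
    rw [div_lt_iff₀ (by positivity)] at h1
    calc (k : ℝ) < r ^ ν * (volume.real Ω * β) := h1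
      _ = β * r ^ ν * volume.real Ω := by ring
  refine (mul_le_mul_of_nonneg_left hmain ?_).trans_eq ?_
  · exact_mod_cast (one_div_pos.2 hk0).le
  rw [← EReal.coe_mul, ← hr₀2, setAverage_eq, setAverage_eq, smul_eq_mul, smul_eq_mul]
  have hsplit : ∫ x in Ω, (V x + ‖∇ ρ x‖ ^ 2) * w x =
      (∫ x in Ω, ‖∇ ρ x‖ ^ 2 * w x) + ∫ x in Ω, V x * w x := by
    rw [← integral_add hgradw hVw]
    refine integral_congr_ae (Filter.Eventually.of_forall fun x => ?_)
    simp only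
    ring
  rw [hsplit]
  congr 1
  field_simp
  ring
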